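/- **Setting.** Let $\Gamma\subset\mathrm{Isom}(\mathbb R^d)$ be a splitting crystal group: a subgroup that is discrete for pointwise convergence, has a compact fundamental domain, and consists of the maps $\gamma=(g,k):x\mapsto g(x+k)$ with $g\in G$, $k\in\Lambda$, where $G\subset O(d)$ is the (finite) point group of $\Gamma$ and $\Lambda\subset\mathbb R^d$ its lattice of translations. Write $G=\{g_1=\mathrm{Id},\dots,g_r\}$ and let $\Lambda^*$ be the dual lattice of $\Lambda$. Let $a$ be a $\Gamma$-admissible matrix: all its eigenvalues have modulus $>1$ and $a\Gamma a^{-1}\subset\Gamma$. Put $m=|\det a|$, let $d_0,\dots,d_{m-1}$ be representatives of $\Lambda/a\Lambda$ and $\varrho_0,\dots,\varrho_{m-1}$ representatives of $\Lambda^*/a^*\Lambda^*$. For an invertible affine map $\gamma$ put $D_\gamma f(x)=|\det\mathrm{lin}(\gamma)|^{-1/2}f(\gamma^{-1}x)$. Let $\{\mathcal V_j\}_{j\in\mathbb Z}$ be a $(\Gamma,a)$-MRA of multiplicity 1 with scaling function $\phi$: closed subspaces of $L^2(\mathbb R^d)$ with $\mathcal V_j\subset\mathcal V_{j+1}=D_a^{-1}\mathcal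 V_j$, $\bigcap_j\mathcal V_j=\{0\}$, $\bigcup_j\mathcal V_j$ dense, such that $\{D_\gamma\phi\}_{\gamma\in\Gamma}$ is an orthonormal basis of $\mathcal V_0$. Let $\mathcal W_0=\mathcal V_1\ominus\mathcal V_0$ and $\Phi=(\phi\circ g_1^{-1},\dots,\phi\circ g_r^{-1})^T$. For each $i$ let $g_{h_i}=ag_ia^{-1}\in G$ and let $\rho_i$ be the permutation with $g_{\rho_i(j)}=g_{h_i}^{-1}g_j$. A family $(c_k)_{k\in\Lambda}$ of matrices $c_k=(c_{i,j}^k)\in\mathbb C^{r\times r}$ has *$(\Gamma,a)$-symmetry* if $c_{i,j}^k=c_{1,\rho_i(j)}^{g_{h_i}^{-1}k}$ for all $i,j,k$. Let $\mathbb V_1$ be the set of vector functions $F=\sum_{k\in\Lambda}c_k\Phi(a\cdot-k)$ (convergent in $L^2$) with components in $\mathcal V_1$ whose coefficients $c_k$ have $(\Gamma,a)$-symmetry. For $f=\sum_{\gamma}c_\gamma\,\phi(\gamma^{-1}(a\,\cdot))\in\mathcal V_1$, its coefficient matrices are $\widetilde c_k=\big(c_{(g_{h_i}^{-1}g_j,\;g_j^{-1}k)}\big)_{i,j=1,\dots,r}$,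 $k\in\Lambda$. Let $\widetilde c_{0,k}$ be the coefficient matrices of $\phi$. Given further square-summable families $\widetilde c_{l,k}$, $l=1,\dots,m-1$, put, as Fourier series converging in $L^2$ on compact sets, $$M_l(\omega)=\frac1m\sum_{k\in\Lambda}\widetilde c_{l,k}e^{-2\pi ik\cdot\omega},\qquad u_{lh}(\omega)=\frac1{\sqrt m}\sum_{k\in\Lambda}\widetilde c_{l,ak+d_h}e^{-2\pi ik\cdot\omega},$$ $$\mathcal M(\omega)=\big[M_i(\omega+(a^*)^{-1}\varrho_j)\big]_{i,j=0}^{m-1},\qquad \mathcal U(\omega)=\big[u_{lh}(\omega)\big]_{l,h=0}^{m-1}.$$ **Theorem.** (1) Let $\psi^1,\dots,\psi^{m-1}\in\mathcal V_1$, let $\widetilde c_{l,k}$ be the coefficient matrices of $\psi^l$, and let $\Psi_l=(\psi^l\circ g_1^{-1},\dots,\psi^l\circ g_r^{-1})^T$. The following are equivalent: (a) $\{D_\gamma\psi^l\}_{\gamma\in\Gamma,\,l=1,\dots,m-1}$ is an orthonormal basis of $\mathcal W_0$; (b) $\mathcal U$ is unitary a.e., and $\Psi_l\in\mathbb V_1$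 for $l=1,\dots,m-1$; (c) $\mathcal M$ is unitary a.e., and $\Psi_l\in\mathbb V_1$ for $l=1,\dots,m-1$; (d) $\frac1m\sum_{k\in\Lambda}\widetilde c_{i,k}\,\widetilde c_{j,k-av}^{\,*}=\delta_{0,v}\delta_{i,j}I_{r\times r}$ for all $v\in\Lambda$ and $i,j=0,\dots,m-1$, and each family $(\widetilde c_{i,k})_{k\in\Lambda}$ has $(\Gamma,a)$-symmetry. (2) Let instead $(\widetilde c_{l,k})_{k\in\Lambda}$, $l=1,\dots,m-1$, be arbitrary square-summable families of $r\times r$ matrices, and let $\Psi_l=\sum_{k\in\Lambda}\widetilde c_{l,k}\Phi(a\cdot-k)$ be the vector functions associated with them. Then (b), (c) and (d) are equivalent to one another, and to: (a$'$) there are functions $\psi^1,\dots,\psi^{m-1}$ with $\Psi_l=(\psi^l\circ g_1^{-1},\dots,\psi^l\circ g_r^{-1})^T$ for all $l$ such that (a) holds. -/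

import Mathlib

open MeasureTheory Filter Topology
open scoped ENNReal

noncomputable section

namespace CrystalWavelet

/-! ### Crystal groups -/

/-- Euclidean space of dimension `d`. -/
abbrev E (d : ℕ) := EuclideanSpace ℝ (Fin d)

/-- A crystal group: a subgroup of the isometry group of Euclidean space that is discrete for the
topology of pointwise convergence and that has a compact fundamental domain. -/
structure IsCrystalGroup {d : ℕ} (Γ : Subgroup (E d ≃ᵃⁱ[ℝ] E d)) : Prop where
  /-- `E d → E d` carries the product topology, i.e. pointwise convergence. -/
  discrete : DiscreteTopology {f : E d → E d | ∃ γ ∈ Γ, ⇑γ = f}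
  fundamental : ∃ P : Set (E d), IsCompact P ∧ (⋃ γ ∈ Γ, γ '' P) = Set.univ ∧
    ∀ γ ∈ Γ, ∀ γ' ∈ Γ, (γ '' interior P ∩ γ' '' interior P).Nonempty → γ = γ'

/-- A splitting crystal group: the linear part of each element belongs to the group, so that the
group is the semidirect product of its linear elements and its translations, and its elements
are exactly the maps `x ↦ g (x + k)`, with `g` in the point group and `k` in the lattice. -/
structure SplittingCrystalGroup (d : ℕ) where
  grp : Subgroup (E d ≃ᵃⁱ[ℝ] E d)
  crystal : IsCrystalGroup grp
  split : ∀ γ ∈ grp, γ.linearIsometryEquiv.toAffineIsometryEquiv ∈ grp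

namespace SplittingCrystalGroup

variable {d : ℕ} (Γ : SplittingCrystalGroup d)

/-- The point group `G`: the group of the linear parts of the elements of `Γ`. -/
def pointGroup : Subgroup (E d ≃ₗᵢ[ℝ] E d) where
  carrier := {g | ∃ γ ∈ Γ.grp, γ.linearIsometryEquiv = g}
  one_mem' := ⟨1, Γ.grp.one_mem, by ext x; rfl⟩
  mul_mem' := by
    rintro _ _ ⟨γ, hγ, rfl⟩ ⟨δ, hδ, rfl⟩
    exact ⟨γ * δ, Γ.grp.mul_mem hγ hδ, by ext x; rfl⟩
  inv_mem' := by
    rintro _ ⟨γ, hγ, rfl⟩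
    exact ⟨γ⁻¹, Γ.grp.inv_mem hγ, by ext x; rfl⟩

/-- The lattice `Λ` of the translations in `Γ`. -/
def lattice : AddSubgroup (E d) where
  carrier := {k | AffineIsometryEquiv.constVAdd ℝ (E d) k ∈ Γ.grp}
  zero_mem' := by
    have : AffineIsometryEquiv.constVAdd ℝ (E d) (0 : E d) = 1 := by ext x; simp
    simp only [Set.mem_ofPred_eq, this]
    exact Γ.grp.one_mem
  add_mem' := by
    intro k l hk hl
    have : AffineIsometryEquiv.constVAdd ℝ (E d) (k + l)
        = AffineIsometryEquiv.constVAdd ℝ (E d) k * AffineIsometryEquiv.constVAdd ℝ (E d) l := by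
      ext x; simp [add_assoc]
    simp only [Set.mem_ofPred_eq, this]
    exact Γ.grp.mul_mem hk hl
  neg_mem' := by
    intro k hk
    have : AffineIsometryEquiv.constVAdd ℝ (E d) (-k)
        = (AffineIsometryEquiv.constVAdd ℝ (E d) k)⁻¹ := by
      rw [eq_inv_iff_mul_eq_one]
      ext x; simp
    simp only [Set.mem_ofPred_eq, this]
    exact Γ.grp.inv_mem hk

/-- The dual lattice `Λ*`. -/
def dualLattice : AddSubgroup (E d) where
  carrier := {ω | ∀ k ∈ Γ.lattice, ∃ z : ℤ, inner ℝ k ω = (z : ℝ)}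
  zero_mem' := fun k _ => ⟨0, by simp⟩
  add_mem' := by
    intro ω ω' h h' k hk
    obtain ⟨z, hz⟩ := h k hk
    obtain ⟨z', hz'⟩ := h' k hk
    exact ⟨z + z', by rw [inner_add_right, hz, hz']; push_cast; ring⟩
  neg_mem' := by
    intro ω h k hk
    obtain ⟨z, hz⟩ := h k hk
    exact ⟨-z, by rw [inner_neg_right, hz]; push_cast; ring⟩

theorem toAffine_mem (g : Γ.pointGroup) :
    (g : E d ≃ₗᵢ[ℝ] E d).toAffineIsometryEquiv ∈ Γ.grp := by
  obtain ⟨g, γ, hγ, rfl⟩ := g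
  exact Γ.split γ hγ

/-- The point group is finite. -/
instance finite_pointGroup : Finite Γ.pointGroup := by
  by_contra hfin
  rw [not_finite_iff_infinite] at hfin
  let u : ℕ ↪ Γ.pointGroup := Infinite.natEmbedding _
  let A : ℕ → (E d →L[ℝ] E d) := fun n =>
    ((u n : E d ≃ₗᵢ[ℝ] E d).toContinuousLinearEquiv : E d →L[ℝ] E d)
  have hA : ∀ n, A n ∈ Metric.closedBall (0 : E d →L[ℝ] E d) 1 := by
    intro n
    rw [mem_closedBall_zero_iff]
    refine ContinuousLinearMap.opNorm_le_bound _ zero_le_one fun x => ?_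
    simp [A]
  obtain ⟨L, -, p, hp, hL⟩ :=
    (isCompact_closedBall (0 : E d →L[ℝ] E d) 1).tendsto_subseq hA
  let h : ℕ → Γ.pointGroup := fun n => (u (p n))⁻¹ * u (p (n + 1))
  have hlim : Tendsto (fun n => (fun x : E d => (h n : E d ≃ₗᵢ[ℝ] E d) x)) atTop
      (𝓝 (id : E d → E d)) := by
    rw [tendsto_pi_nhds]
    intro x
    have h1 : Tendsto (fun n => A (p n) x) atTop (𝓝 (L x)) :=
      ((ContinuousLinearMap.apply ℝ (E d) x).continuous.tendsto L).comp hL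
    have h2 : Tendsto (fun n => A (p (n + 1)) x - A (p n) x) atTop (𝓝 0) := by
      simpa using (h1.comp (tendsto_add_atTop_nat 1)).sub h1
    rw [tendsto_iff_norm_sub_tendsto_zero]
    have h3 := h2.norm
    rw [norm_zero] at h3
    refine h3.congr fun n => ?_
    have e1 : (h n : E d ≃ₗᵢ[ℝ] E d) x - id x
        = (u (p n) : E d ≃ₗᵢ[ℝ] E d).symm
          ((u (p (n + 1)) : E d ≃ₗᵢ[ℝ] E d) x - (u (p n) : E d ≃ₗᵢ[ℝ] E d) x) := by
      rw [map_sub, LinearIsometryEquiv.symm_apply_apply]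
      rfl
    rw [e1, LinearIsometryEquiv.norm_map]
    rfl
  have hmem : ∀ g : Γ.pointGroup, (fun x : E d => (g : E d ≃ₗᵢ[ℝ] E d) x)
      ∈ {f : E d → E d | ∃ γ ∈ Γ.grp, ⇑γ = f} := fun g => ⟨_, Γ.toAffine_mem g, rfl⟩
  have hid : (id : E d → E d) ∈ {f : E d → E d | ∃ γ ∈ Γ.grp, ⇑γ = f} :=
    ⟨1, Γ.grp.one_mem, rfl⟩
  have := Γ.crystal.discrete
  have hlim' : Tendsto (fun n => (⟨_, hmem (h n)⟩ : {f : E d → E d | ∃ γ ∈ Γ.grp, ⇑γ = f}))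
      atTop (𝓝 ⟨id, hid⟩) := tendsto_subtype_rng.2 hlim
  rw [nhds_discrete, tendsto_pure] at hlim'
  obtain ⟨n, hn⟩ := hlim'.exists
  have hn' : (fun x : E d => (h n : E d ≃ₗᵢ[ℝ] E d) x) = id := congrArg Subtype.val hn
  have h1 : h n = 1 := by
    ext1
    refine LinearIsometryEquiv.ext fun x => congrFun hn' x
  have h2 : u (p (n + 1)) = u (p n) := (inv_mul_eq_one.1 h1).symm
  have h3 := u.injective h2
  exact absurd h3 (hp (Nat.lt_succ_self n)).ne'

instance : Fintype Γ.pointGroup := Fintype.ofFinite _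

instance : DecidableEq Γ.pointGroup := Classical.decEq _

theorem map_lattice_mem (g : Γ.pointGroup) (k : Γ.lattice) :
    (g : E d ≃ₗᵢ[ℝ] E d) k ∈ Γ.lattice := by
  have h := Γ.grp.mul_mem (Γ.grp.mul_mem (Γ.toAffine_mem g) k.2)
    (Γ.grp.inv_mem (Γ.toAffine_mem g))
  have e : (g : E d ≃ₗᵢ[ℝ] E d).toAffineIsometryEquiv
        * AffineIsometryEquiv.constVAdd ℝ (E d) (k : E d)
        * ((g : E d ≃ₗᵢ[ℝ] E d).toAffineIsometryEquiv)⁻¹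
      = AffineIsometryEquiv.constVAdd ℝ (E d) ((g : E d ≃ₗᵢ[ℝ] E d) k) := by
    rw [mul_inv_eq_iff_eq_mul]
    ext x; simp
  rw [e] at h
  exact h

/-- The action of the point group on the lattice. -/
def act (g : Γ.pointGroup) (k : Γ.lattice) : Γ.lattice :=
  ⟨(g : E d ≃ₗᵢ[ℝ] E d) k, Γ.map_lattice_mem g k⟩

/-- The element `(g, k)` of `Γ`, that is, the map `x ↦ g (x + k)`. -/
def elt (g : Γ.pointGroup) (k : Γ.lattice) : Γ.grp :=
  ⟨(g : E d ≃ₗᵢ[ℝ] E d).toAffineIsometryEquiv * AffineIsometryEquiv.constVAdd ℝ (E d) (k : E d),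
    Γ.grp.mul_mem (Γ.toAffine_mem g) k.2⟩

end SplittingCrystalGroup

/-- A `Γ`-admissible matrix `a`: all complex eigenvalues have modulus larger than `1` (which makes
`a` invertible) and `a Γ a⁻¹ ⊆ Γ`. -/
structure AdmissibleMatrix {d : ℕ} (Γ : SplittingCrystalGroup d) where
  lin : E d ≃ₗ[ℝ] E d
  expanding : ∀ μ : ℂ, Polynomial.aeval μ (lin : E d →ₗ[ℝ] E d).charpoly = 0 → 1 < ‖μ‖
  conj_mem : ∀ γ ∈ Γ.grp, ∃ γ' ∈ Γ.grp, ∀ x, γ' x = lin (γ (lin.symm x))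

namespace AdmissibleMatrix

variable {d : ℕ} {Γ : SplittingCrystalGroup d} (a : AdmissibleMatrix Γ)

theorem exists_conj (g : Γ.pointGroup) : ∃ g' : Γ.pointGroup, ∀ x,
    (g' : E d ≃ₗᵢ[ℝ] E d) x = a.lin ((g : E d ≃ₗᵢ[ℝ] E d) (a.lin.symm x)) := by
  obtain ⟨γ', hγ', h⟩ := a.conj_mem _ (Γ.toAffine_mem g)
  refine ⟨⟨γ'.linearIsometryEquiv, γ', hγ', rfl⟩, fun x => ?_⟩
  have h0 : γ' 0 = 0 := by rw [h]; simp
  have h1 := γ'.map_vadd 0 x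
  simp only [vadd_eq_add, add_zero, h0] at h1
  rw [← h1, h]
  rfl

/-- The element `a g a⁻¹` of the point group. -/
def conj (g : Γ.pointGroup) : Γ.pointGroup := (a.exists_conj g).choose

theorem conj_apply (g : Γ.pointGroup) (x : E d) :
    (a.conj g : E d ≃ₗᵢ[ℝ] E d) x = a.lin ((g : E d ≃ₗᵢ[ℝ] E d) (a.lin.symm x)) :=
  (a.exists_conj g).choose_spec x

theorem lin_mem (k : Γ.lattice) : a.lin k ∈ Γ.lattice := by
  obtain ⟨γ', hγ', h⟩ := a.conj_mem _ k.2
  have e : γ' = AffineIsometryEquiv.constVAdd ℝ (E d) (a.lin k) := by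
    ext1 x; rw [h]; simp
  rw [e] at hγ'
  exact hγ'

/-- The map `k ↦ a k` of the lattice. -/
def onLattice (k : Γ.lattice) : Γ.lattice := ⟨a.lin k, a.lin_mem k⟩

end AdmissibleMatrix

/-- `t` lists, without repetition, representatives of the quotient `L / T(L)`. -/
def IsCosetReps {d m : ℕ} (L : AddSubgroup (E d)) (T : E d →ₗ[ℝ] E d) (t : Fin m → L) : Prop :=
  ∀ k : L, ∃! h : Fin m, ∃ l : L, (k : E d) = T l + t h

/-! ### Operators on `L²` -/

/-- The Hilbert space `L²(ℝ^d)`. -/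
abbrev L2 (d : ℕ) := Lp ℂ 2 (volume : Measure (E d))

theorem memLp_comp_affine {d : ℕ} (e : E d ≃ᵃ[ℝ] E d) (f : L2 d) :
    MemLp (fun x => f (e x)) 2 (volume : Measure (E d)) := by
  have hl : LinearMap.det (e.linear : E d →ₗ[ℝ] E d) ≠ 0 := (LinearEquiv.isUnit_det' e.linear).ne_zero
  have hc : Measurable (e.linear : E d →ₗ[ℝ] E d) :=
    (LinearMap.continuous_of_finiteDimensional _).measurable
  have he : ⇑e = (fun y => y + e 0) ∘ (e.linear : E d →ₗ[ℝ] E d) := by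
    funext x
    have := e.map_vadd 0 x
    simpa using this
  have hm : Measurable e := by
    rw [he]
    exact (measurable_add_const _).comp hc
  have hmap : Measure.map e (volume : Measure (E d))
      = ENNReal.ofReal |(LinearMap.det (e.linear : E d →ₗ[ℝ] E d))⁻¹| • volume := by
    rw [he, ← Measure.map_map (measurable_add_const _) hc,
      Measure.map_linearMap_addHaar_eq_smul_addHaar volume hl, Measure.map_smul,
      map_add_right_eq_self]
  refine MemLp.comp_of_map ?_ hm.aemeasurable
  rw [hmap]
  exact (Lp.memLp f).smul_measure ENNReal.ofReal_ne_top

/-- The composition `x ↦ f (e x)` of `f ∈ L²` with an invertible affine map `e`. -/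
def comp {d : ℕ} (f : L2 d) (e : E d ≃ᵃ[ℝ] E d) : L2 d := (memLp_comp_affine e f).toLp _

/-- The unitary operator `D_e f (x) = |det lin(e)|^(-1/2) f (e⁻¹ x)`. -/
def D {d : ℕ} (e : E d ≃ᵃ[ℝ] E d) (f : L2 d) : L2 d :=
  (((Real.sqrt |LinearMap.det (e.linear : E d →ₗ[ℝ] E d)|)⁻¹ : ℝ) : ℂ) • comp f e.symm

/-- `v` is an orthonormal basis of the closed subspace `W`. -/
def IsONBOf {d : ℕ} {ι : Type*} (v : ι → L2 d) (W : Submodule ℂ (L2 d)) : Prop :=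
  Orthonormal ℂ v ∧ (Submodule.span ℂ (Set.range v)).topologicalClosure = W

variable {d : ℕ} {Γ : SplittingCrystalGroup d}

/-- `V` is an orthogonal `(Γ, a)`-multiresolution analysis of multiplicity `n` with
crystal-scaling function vector `Φ`. -/
structure IsMRA (a : AdmissibleMatrix Γ) {n : ℕ} (Φ : Fin n → L2 d)
    (V : ℤ → Submodule ℂ (L2 d)) : Prop where
  closed : ∀ j, IsClosed (V j : Set (L2 d))
  mono : ∀ j, V j ≤ V (j + 1)
  /-- `V (j + 1) = D_a⁻¹ (V j)` -/
  dilate : ∀ j, (V (j + 1) : Set (L2 d)) = D a.lin.symm.toAffineEquiv '' (V j : Set (L2 d))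
  inter : (⨅ j, V j) = ⊥
  dense : Dense (⋃ j, (V j : Set (L2 d)))
  basis : IsONBOf (fun p : Γ.grp × Fin n =>
    D (p.1 : E d ≃ᵃⁱ[ℝ] E d).toAffineEquiv (Φ p.2)) (V 0)

/-- The orthogonal complement `W_j` of `V_j` in `V_{j+1}`. -/
def W (V : ℤ → Submodule ℂ (L2 d)) (j : ℤ) : Submodule ℂ (L2 d) := (V j)ᗮ ⊓ V (j + 1)

/-! ### Coefficients -/

/-- The vector function `(D_g f)_{g ∈ G}`, that is, `(f ∘ g⁻¹)_{g ∈ G}`. -/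
def orbitVec (f : L2 d) (g : Γ.pointGroup) : L2 d :=
  D (g : E d ≃ₗᵢ[ℝ] E d).toLinearEquiv.toAffineEquiv f

/-- `f(x) = ∑_γ c_γ φ(γ⁻¹(a x))` in `L²`. -/
def HasScalarExpansion (a : AdmissibleMatrix Γ) (φ : L2 d) (c : Γ.grp → ℂ) (f : L2 d) : Prop :=
  HasSum (fun γ : Γ.grp => c γ • comp φ
    (a.lin.toAffineEquiv.trans (γ : E d ≃ᵃⁱ[ℝ] E d).symm.toAffineEquiv)) f

/-- The matrices `c̃_k = (c_{((a g a⁻¹)⁻¹ g', g'⁻¹ k)})_{g, g' ∈ G}` built from scalar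
coefficients. -/
def coeffMatrix (a : AdmissibleMatrix Γ) (c : Γ.grp → ℂ) (k : Γ.lattice) :
    Matrix Γ.pointGroup Γ.pointGroup ℂ :=
  Matrix.of fun g g' => c (Γ.elt ((a.conj g)⁻¹ * g') (Γ.act g'⁻¹ k))

/-- `(Γ, a)`-symmetry of a family of matrices. -/
def HasSymmetry (a : AdmissibleMatrix Γ)
    (c : Γ.lattice → Matrix Γ.pointGroup Γ.pointGroup ℂ) : Prop :=
  ∀ (g g' : Γ.pointGroup) (k : Γ.lattice),
    c k g g' = c (Γ.act (a.conj g)⁻¹ k) 1 ((a.conj g)⁻¹ * g')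

/-- The term `c_k Φ(a x - k)`, where `Φ = (φ ∘ g⁻¹)_{g ∈ G}`. -/
def vecTerm (a : AdmissibleMatrix Γ) (φ : L2 d)
    (c : Γ.lattice → Matrix Γ.pointGroup Γ.pointGroup ℂ) (k : Γ.lattice)
    (g : Γ.pointGroup) : L2 d :=
  ∑ g' : Γ.pointGroup, c k g g' • comp (orbitVec φ g')
    (a.lin.toAffineEquiv.trans (AffineEquiv.constVAdd ℝ (E d) (-(k : E d))))

/-- The set `𝕍₁` of the vector functions `F` with components in `V₁` that have an expansion
`F(x) = ∑_k c_k Φ(a x - k)` whose coefficients have `(Γ, a)`-symmetry. -/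
def symV1 (a : AdmissibleMatrix Γ) (φ : L2 d) (V : ℤ → Submodule ℂ (L2 d)) :
    Set (Γ.pointGroup → L2 d) :=
  {F | (∀ g, F g ∈ V 1) ∧ ∃ c : Γ.lattice → Matrix Γ.pointGroup Γ.pointGroup ℂ,
    (∀ g, HasSum (fun k => vecTerm a φ c k g) (F g)) ∧ HasSymmetry a c}

/-- The vector function `∑_k c_k Φ(a x - k)` associated with matrices `c_k`; its Fourier
transform `Ψ̂` satisfies `Ψ̂(a*ω) = M(ω) Φ̂(ω)`, with `M(ω) = (1/m) ∑_k c_k e^{-2π i k·ω}`. -/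
def assocVec (a : AdmissibleMatrix Γ) (φ : L2 d)
    (c : Γ.lattice → Matrix Γ.pointGroup Γ.pointGroup ℂ) (g : Γ.pointGroup) : L2 d :=
  ∑' k, vecTerm a φ c k g

/-- All entries of the family `c` of matrices are square-summable. -/
def SquareSummable (c : Γ.lattice → Matrix Γ.pointGroup Γ.pointGroup ℂ) : Prop :=
  ∀ g g', Summable fun k => ‖c k g g'‖ ^ 2

/-- The families `c̃_0, …, c̃_n`: the one built from the scalar coefficients `c₀`, followed by
given families `C_1, …, C_n`. -/
def allCoeff {n : ℕ} (a : AdmissibleMatrix Γ) (c₀ : Γ.grp → ℂ)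
    (C : Fin n → Γ.lattice → Matrix Γ.pointGroup Γ.pointGroup ℂ) :
    Fin (n + 1) → Γ.lattice → Matrix Γ.pointGroup Γ.pointGroup ℂ :=
  Fin.cons (coeffMatrix a c₀) C

/-! ### Symbols -/

/-- `f` is the sum of `∑_k c_k e^{-2π i k·ω}`, in the sense of (unconditional) convergence in
`L²` on every compact set. -/
def IsFourierSum (c : Γ.lattice → ℂ) (f : E d → ℂ) : Prop :=
  AEStronglyMeasurable f volume ∧ ∀ K : Set (E d), IsCompact K →
    Tendsto (fun s : Finset Γ.lattice => eLpNorm (fun ω => f ω - ∑ k ∈ s,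
      c k * Complex.exp (-2 * Real.pi * Complex.I * (inner ℝ (k : E d) ω : ℝ))) 2
        (volume.restrict K)) atTop (𝓝 0)

/-- The function `ω ↦ ∑_k c_k e^{-2π i k·ω}`, determined almost everywhere. It exists for every
square-summable family `c`. -/
def fourierSum (c : Γ.lattice → ℂ) : E d → ℂ := Classical.epsilon (IsFourierSum c)

/-- The symbol `M(ω) = (1/m) ∑_k c_k e^{-2π i k·ω}`. -/
def symbol (m : ℕ) (c : Γ.lattice → Matrix Γ.pointGroup Γ.pointGroup ℂ) (ω : E d) :
    Matrix Γ.pointGroup Γ.pointGroup ℂ :=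
  Matrix.of fun g g' => fourierSum (fun k => (1 / (m : ℂ)) * c k g g') ω

/-- The polyphase component `u(ω) = (1/√m) ∑_k c_{a k + t} e^{-2π i k·ω}`. -/
def polyphase (m : ℕ) (a : AdmissibleMatrix Γ)
    (c : Γ.lattice → Matrix Γ.pointGroup Γ.pointGroup ℂ) (t : Γ.lattice) (ω : E d) :
    Matrix Γ.pointGroup Γ.pointGroup ℂ :=
  Matrix.of fun g g' =>
    fourierSum (fun k => ((1 / Real.sqrt m : ℝ) : ℂ) * c (a.onLattice k + t) g g') ω

/-- The block matrix `𝒰 = [u_{lh}]_{l, h = 0, …, m-1}`, for digits `t`. -/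
def matU {m : ℕ} (a : AdmissibleMatrix Γ) (t : Fin m → Γ.lattice)
    (c : Fin m → Γ.lattice → Matrix Γ.pointGroup Γ.pointGroup ℂ) (ω : E d) :
    Matrix (Fin m × Γ.pointGroup) (Fin m × Γ.pointGroup) ℂ :=
  Matrix.of fun p q => polyphase m a (c p.1) (t q.1) ω p.2 q.2

/-- The block matrix `ℳ(ω) = [M_i(ω + (a*)⁻¹ ϱ_j)]_{i, j = 0, …, m-1}`. Here `(a*)⁻¹` is
written as the adjoint of `a⁻¹`. -/
def matM {m : ℕ} (a : AdmissibleMatrix Γ) (ϱ : Fin m → Γ.dualLattice)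
    (c : Fin m → Γ.lattice → Matrix Γ.pointGroup Γ.pointGroup ℂ) (ω : E d) :
    Matrix (Fin m × Γ.pointGroup) (Fin m × Γ.pointGroup) ℂ :=
  Matrix.of fun p q => symbol m (c p.1)
    (ω + LinearMap.adjoint (a.lin.symm : E d →ₗ[ℝ] E d) (ϱ q.1)) p.2 q.2

/-- The square matrix valued function `A` is unitary almost everywhere. -/
def UnitaryAE {ι : Type*} [Fintype ι] [DecidableEq ι] (A : E d → Matrix ι ι ℂ) : Prop :=
  ∀ᵐ ω ∂(volume : Measure (E d)), A ω ∈ Matrix.unitaryGroup ι ℂ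

/-- The relations `(1/m) ∑_k c_{i,k} c*_{j,k-av} = δ_{0,v} δ_{i,j} I`. -/
def DiscreteOrthogonality {m : ℕ} (a : AdmissibleMatrix Γ)
    (c : Fin m → Γ.lattice → Matrix Γ.pointGroup Γ.pointGroup ℂ) : Prop :=
  ∀ (v : Γ.lattice) (i j : Fin m), HasSum
    (fun k : Γ.lattice => (1 / (m : ℂ)) • (c i k * (c j (k - a.onLattice v)).conjTranspose))
    (open Classical in if v = 0 ∧ i = j then 1 else 0)

/-- The family `D_γ ψ^l` is an orthonormal basis of `W_0`. -/
def TranslatesBasis (V : ℤ → Submodule ℂ (L2 d)) {n : ℕ} (ψ : Fin n → L2 d) : Prop :=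
  IsONBOf (fun p : Γ.grp × Fin n => D (p.1 : E d ≃ᵃⁱ[ℝ] E d).toAffineEquiv (ψ p.2)) (W V 0)

end CrystalWavelet

end

/-!
Everything is reduced to square-summable families `c̃_0, …, c̃_n` of coefficient matrices of
functions `ψ^0 = φ, ψ^1, …, ψ^n` in `V₁`, with `m = n + 1`.

*Translates and discrete orthogonality.* The functions `√m φ(g⁻¹(a x - k))`, for `g` in the point
group and `k ∈ Λ`, form an orthonormal basis of `V₁` (`IsMRA.V_one_eq`). In it, the translate of
`ψ^i ∘ g⁻¹` by `v` has as coefficients the `g`-th rows of `c̃_{i,k-av} / √m`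
(`HasScalarExpansion.hasSum_D`). Hence discrete orthogonality says exactly that all the `D_γ ψ^i`,
`i = 0, …, n`, together form an orthonormal family (`orthonormal_D_iff`). Such a family is
automatically complete in `V₁`: Bessel's inequality for the squared coefficients of the basis
vectors, summed over representatives of the translation orbits, has on both sides the number of
generators, so that it is an equality for each basis vector (`mem_closure_span_of_card_eq`). As
`ψ^0 = φ` generates `V₀`, the translates of the other functions then form an orthonormal basis of
`W₀` (`translatesBasis_iff_orthonormal`).

*Discrete orthogonality and `𝒰`.* Coordinates on `Λ` identify the dual torus with `(ℝ/ℤ)^d`, and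
Fourier sums are pulled back from functions in `L²` of the torus (`fourierSum_ae_eq`). The sums in
the discrete orthogonality relations are the Fourier coefficients of the entries of `𝒰 𝒰*`
(`hasSum_matU_coeff`), and integrable functions are determined by their Fourier coefficients. Thus
the relations mean `𝒰 𝒰* = 1` almost everywhere, which is unitarity because `𝒰` is a square matrix
(`unitaryAE_matU_iff`).

*`𝒰` and `ℳ`.* Splitting the series of `M_i` over the cosets of `a Λ` gives
`ℳ(ω) = 𝒰(a* ω) X(ω)`, where `X(ω)` is unitary because its entries are, up to a diagonal unitary
factor, the normalized values of the characters of `Λ / a Λ` (`matM_ae_eq`,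
`charMatrix_mem_unitary`, `unitaryAE_matM_iff`).

*Symmetry.* Coefficient matrices of a function are always symmetric, each symmetric square-summable
family arises in this way, and the coefficients of a vector function are unique (`coeff_unique`).
So for arbitrary families each of the four conditions forces symmetry, which leads back to
functions `ψ^l` in `V₁`.
-/

open MeasureTheory Filter Topology
open scoped ENNReal

noncomputable section

namespace CrystalWavelet

/-! ### Coordinates on the lattice -/

namespace SplittingCrystalGroup

variable {d : ℕ} (Γ : SplittingCrystalGroup d)

instance discreteTopology_lattice : DiscreteTopology Γ.lattice := by
  have := Γ.crystal.discrete
  let F : Γ.lattice → {f : E d → E d | ∃ γ ∈ Γ.grp, ⇑γ = f} := fun k =>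
    ⟨fun x => (k : E d) + x, _, k.2, by ext x; simp⟩
  refine DiscreteTopology.of_continuous_injective (f := F) ?_ ?_
  · refine Continuous.subtype_mk ?_ _
    fun_prop
  · intro k l h
    have h1 := congrFun (congrArg Subtype.val h) 0
    exact Subtype.ext (by simpa [F] using h1)

/-- Since `Γ` contains the linear parts of its elements, it contains their translation parts. -/
theorem apply_zero_mem_lattice (γ : E d ≃ᵃⁱ[ℝ] E d) (hγ : γ ∈ Γ.grp) : γ 0 ∈ Γ.lattice := by
  have h := Γ.grp.mul_mem hγ (Γ.grp.inv_mem (Γ.split γ hγ))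
  have e : γ * (γ.linearIsometryEquiv.toAffineIsometryEquiv)⁻¹
      = AffineIsometryEquiv.constVAdd ℝ (E d) (γ 0) := by
    rw [mul_inv_eq_iff_eq_mul]
    ext1 x
    have := γ.map_vadd 0 x
    simp only [vadd_eq_add, add_zero] at this
    simp [this, add_comm]
  rw [e] at h
  exact h

/-- The lattice has full rank: a vector `w` orthogonal to it satisfies `N ‖w‖² ≤ C ‖w‖` for all
`N`, because `N w` lies in the image of the compact fundamental domain under some `γ ∈ Γ`. -/
theorem span_lattice : Submodule.span ℝ (Γ.lattice : Set (E d)) = ⊤ := by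
  obtain ⟨P, hP, hcov, -⟩ := Γ.crystal.fundamental
  obtain ⟨R, hR⟩ := hP.isBounded.exists_norm_le
  rw [← Submodule.orthogonal_eq_bot_iff, Submodule.eq_bot_iff]
  intro w hw
  have key : ∀ N : ℕ, (N : ℝ) * ‖w‖ ^ 2 ≤ ‖w‖ * R := by
    intro N
    have hN : (N : ℝ) • w ∈ ⋃ γ ∈ Γ.grp, γ '' P := hcov ▸ Set.mem_univ _
    simp only [Set.mem_iUnion, Set.mem_image] at hN
    obtain ⟨γ, hγ, p, hp, hx⟩ := hN
    have h1 := γ.map_vadd 0 p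
    simp only [vadd_eq_add, add_zero] at h1
    have h2 : inner ℝ w (γ 0) = 0 := by
      rw [real_inner_comm]
      exact hw _ (Submodule.subset_span (Γ.apply_zero_mem_lattice γ hγ))
    have h3 : inner ℝ w ((N : ℝ) • w) = inner ℝ w (γ.linearIsometryEquiv p) := by
      rw [← hx, h1, inner_add_right, h2, add_zero]
    rw [inner_smul_right, real_inner_self_eq_norm_sq] at h3
    rw [h3]
    refine (real_inner_le_norm _ _).trans ?_
    rw [LinearIsometryEquiv.norm_map]
    exact mul_le_mul_of_nonneg_left (hR p hp) (norm_nonneg _)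
  by_contra hne
  have hpos : 0 < ‖w‖ ^ 2 := by positivity
  obtain ⟨N, hN⟩ := exists_nat_gt (‖w‖ * R / ‖w‖ ^ 2)
  rw [div_lt_iff₀ hpos] at hN
  exact absurd (key N) (not_le.2 hN)

/-- Integer coordinates on the lattice and real coordinates on the frequency space in which the
inner product is the standard one up to sign. The sign turns `e^{-2π i k·ω}` into a monomial of
`mFourier`, without a minus sign in the exponent. -/
theorem exists_coordinates : ∃ (L : E d ≃ₗ[ℝ] (Fin d → ℝ)) (n : Γ.lattice ≃+ (Fin d → ℤ)),
    ∀ (k : Γ.lattice) (ω : E d), inner ℝ (k : E d) ω = -∑ i, (n k i : ℝ) * L ω i := by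
  let Λ : Submodule ℤ (E d) := AddSubgroup.toIntSubmodule Γ.lattice
  have : DiscreteTopology Λ := Γ.discreteTopology_lattice
  have : IsZLattice ℝ Λ := ⟨Γ.span_lattice⟩
  have := ZLattice.module_free ℝ Λ
  have := ZLattice.module_finite ℝ Λ
  have hr : Module.finrank ℤ Λ = d := by rw [ZLattice.rank ℝ Λ]; simp
  let b : Module.Basis (Fin d) ℤ Λ := Module.finBasisOfFinrankEq ℤ Λ hr
  let B := b.ofZLatticeBasis ℝ Λ
  let L₀ : E d →ₗ[ℝ] (Fin d → ℝ) := LinearMap.pi fun i => -(innerₛₗ ℝ (b i : E d))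
  have hL₀ : ∀ ω i, L₀ ω i = -inner ℝ (b i : E d) ω := fun ω i => rfl
  have hinj : Function.Injective L₀ := by
    rw [injective_iff_map_eq_zero]
    intro ω hω
    have h0 : innerₛₗ ℝ ω = 0 := by
      refine B.ext fun i => ?_
      have := congrFun hω i
      rw [hL₀] at this
      simp only [Pi.zero_apply, neg_eq_zero] at this
      rw [innerₛₗ_apply_apply, real_inner_comm]
      simpa [B] using this
    exact inner_self_eq_zero.1 (LinearMap.congr_fun h0 ω)
  have hf : Module.finrank ℝ (E d) = Module.finrank ℝ (Fin d → ℝ) := by simp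
  refine ⟨LinearEquiv.ofInjectiveOfFinrankEq L₀ hinj hf, b.equivFun.toAddEquiv, fun k ω => ?_⟩
  have hk : (k : E d) = ∑ i, (b.equivFun k i) • (b i : E d) := by
    have := congrArg (Submodule.subtype Λ) (b.sum_equivFun k)
    rw [map_sum] at this
    simp only [map_zsmul] at this
    exact this.symm
  rw [hk, sum_inner, ← Finset.sum_neg_distrib]
  refine Finset.sum_congr rfl fun i _ => ?_
  rw [← Int.cast_smul_eq_zsmul ℝ, inner_smul_left]
  change _ = -(((b.equivFun k i : ℤ) : ℝ) * -inner ℝ (b i : E d) ω)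
  simp

/-- Linear coordinates on the frequency space that are adapted to a `ℤ`-basis of the lattice. -/
def freqCoord : E d ≃ₗ[ℝ] (Fin d → ℝ) := Γ.exists_coordinates.choose

/-- Integer coordinates on the lattice. -/
def coord : Γ.lattice ≃+ (Fin d → ℤ) := Γ.exists_coordinates.choose_spec.choose

theorem inner_eq_coord (k : Γ.lattice) (ω : E d) :
    inner ℝ (k : E d) ω = -∑ i, (Γ.coord k i : ℝ) * Γ.freqCoord ω i :=
  Γ.exists_coordinates.choose_spec.choose_spec k ω

instance countable_lattice : Countable Γ.lattice := Γ.coord.toEquiv.countable_iff.2 inferInstance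

/-- The quotient map from the frequency space to the torus `ℝ^d / Λ*`. -/
def torusMap (ω : E d) : UnitAddTorus (Fin d) := fun i => (Γ.freqCoord ω i : UnitAddCircle)

theorem exp_eq_mFourier (k : Γ.lattice) (ω : E d) :
    Complex.exp (-2 * Real.pi * Complex.I * (inner ℝ (k : E d) ω : ℝ))
      = UnitAddTorus.mFourier (Γ.coord k) (Γ.torusMap ω) := by
  rw [inner_eq_coord]
  simp only [UnitAddTorus.mFourier, torusMap, ContinuousMap.coe_mk, fourier_coe_apply]
  rw [← Complex.exp_sum]
  congr 1
  push_cast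
  rw [mul_neg, ← neg_mul, Finset.mul_sum]
  refine Finset.sum_congr rfl fun i _ => ?_
  simp
  ring

theorem torusMap_add_dual (ω : E d) (ϱ : Γ.dualLattice) :
    Γ.torusMap (ω + ϱ) = Γ.torusMap ω := by
  funext i
  simp only [torusMap, map_add, Pi.add_apply, AddCircle.coe_add]
  obtain ⟨z, hz⟩ := ϱ.2 (Γ.coord.symm (Pi.single i 1)) (Γ.coord.symm (Pi.single i 1)).2
  rw [inner_eq_coord] at hz
  simp only [AddEquiv.apply_symm_apply, Pi.single_apply, Int.cast_ite, Int.cast_one,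
    Int.cast_zero, ite_mul, one_mul, zero_mul, Finset.sum_ite_eq', Finset.mem_univ, if_true] at hz
  have : Γ.freqCoord (ϱ : E d) i = ((-z : ℤ) : ℝ) := by push_cast; linarith
  rw [this]
  have h0 : (((-z : ℤ) : ℝ) : UnitAddCircle) = 0 := by
    rw [AddCircle.coe_eq_zero_iff]
    exact ⟨-z, by simp⟩
  rw [h0, add_zero]

end SplittingCrystalGroup

/-! ### The torus -/

section Torus

attribute [local instance] instMeasureSpaceUnitAddCircle

instance isProbabilityMeasure_circle :
    IsProbabilityMeasure (volume : Measure UnitAddCircle) :=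
  inferInstanceAs (IsProbabilityMeasure AddCircle.haarAddCircle)

open UnitAddTorus ComplexConjugate

variable {d : ℕ}

/-- An integrable function on the torus is determined by its Fourier coefficients. -/
theorem ae_eq_zero_of_integral_mFourier_eq_zero {H : UnitAddTorus (Fin d) → ℂ}
    (hH : Integrable H) (h : ∀ n, ∫ t, mFourier n t * H t = 0) : H =ᵐ[volume] 0 := by
  have hbd : ∀ χ : C(UnitAddTorus (Fin d), ℂ), Integrable fun t => χ t * H t := fun χ =>
    hH.bdd_mul χ.continuous.aestronglyMeasurable
      (Eventually.of_forall fun t => χ.norm_coe_le_norm t)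
  -- The trigonometric polynomials are uniformly dense, so that `H` annihilates all continuous
  -- functions, and by approximation the indicator functions of closed sets.
  have hcont : ∀ χ : C(UnitAddTorus (Fin d), ℂ), ∫ t, χ t * H t = 0 := by
    let T : C(UnitAddTorus (Fin d), ℂ) →ₗ[ℂ] ℂ :=
      { toFun := fun χ => ∫ t, χ t * H t
        map_add' := fun χ χ' => by
          simp only [ContinuousMap.add_apply, add_mul]
          exact integral_add (hbd χ) (hbd χ')
        map_smul' := fun c χ => by
          simp only [ContinuousMap.smul_apply, smul_eq_mul, mul_assoc, RingHom.id_apply]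
          exact integral_const_mul _ _ }
    have hT : Continuous T := by
      refine (T.mkContinuous (∫ t, ‖H t‖) fun χ => ?_).continuous
      refine (norm_integral_le_integral_norm _).trans ?_
      rw [mul_comm, ← integral_const_mul]
      refine integral_mono (hbd χ).norm (hH.norm.const_mul _) fun t => ?_
      simp only [norm_mul]
      exact mul_le_mul_of_nonneg_right (χ.norm_coe_le_norm t) (norm_nonneg _)
    have hle : (Submodule.span ℂ (Set.range (mFourier (d := Fin d)))).topologicalClosure
        ≤ LinearMap.ker T := by
      refine Submodule.topologicalClosure_minimal _ ?_ (isClosed_singleton.preimage hT)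
      rw [Submodule.span_le]
      rintro _ ⟨n, rfl⟩
      exact h n
    rw [span_mFourier_closure_eq_top] at hle
    exact fun χ => hle (Submodule.mem_top (x := χ))
  refine ae_eq_zero_of_forall_setIntegral_isClosed_eq_zero hH fun s hs => ?_
  have hlim : Tendsto (fun n => ∫ t, ((hs.apprSeq n t : ℝ) : ℂ) * H t) atTop
      (𝓝 (∫ t, s.indicator H t)) := by
    refine tendsto_integral_of_dominated_convergence (fun t => ‖H t‖) ?_ hH.norm ?_ ?_
    · intro n
      refine AEStronglyMeasurable.mul ?_ hH.aestronglyMeasurable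
      refine Continuous.aestronglyMeasurable ?_
      have := (hs.apprSeq n).continuous
      fun_prop
    · intro n
      refine Eventually.of_forall fun t => ?_
      rw [norm_mul]
      refine mul_le_of_le_one_left (norm_nonneg _) ?_
      have := HasOuterApproxClosed.apprSeq_apply_le_one hs n t
      simpa using this
    · refine Eventually.of_forall fun t => ?_
      have h1 := tendsto_pi_nhds.1 (HasOuterApproxClosed.tendsto_apprSeq hs) t
      have h2 : Tendsto (fun n => ((hs.apprSeq n t : ℝ) : ℂ) * H t) atTop
          (𝓝 ((((s.indicator (fun _ => (1 : NNReal)) t : NNReal) : ℝ) : ℂ) * H t)) := by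
        refine Tendsto.mul_const _ ?_
        exact ((Complex.continuous_ofReal.comp NNReal.continuous_coe).tendsto _).comp h1
      convert h2 using 2
      by_cases ht : t ∈ s <;> simp [ht]
  rw [← integral_indicator hs.measurableSet]
  refine tendsto_nhds_unique hlim ?_
  refine tendsto_const_nhds.congr fun n => ?_
  exact (hcont ⟨fun t => ((hs.apprSeq n t : ℝ) : ℂ), by
    have := (hs.apprSeq n).continuous
    fun_prop⟩).symm

/-- Multiplication by a monomial translates the Fourier coefficients. -/
theorem mFourierCoeff_mFourier_mul (g : UnitAddTorus (Fin d) → ℂ) (n k : Fin d → ℤ) :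
    mFourierCoeff (fun t => mFourier n t * g t) k = mFourierCoeff g (k - n) := by
  unfold mFourierCoeff
  refine integral_congr_ae (Eventually.of_forall fun t => ?_)
  simp only [smul_eq_mul]
  rw [← mul_assoc, ← mFourier_add]
  congr 3
  abel

theorem memLp_mFourier_mul (g : Lp ℂ 2 (volume : Measure (UnitAddTorus (Fin d))))
    (n : Fin d → ℤ) : MemLp (fun t => mFourier n t * g t) 2 volume := by
  refine (Lp.memLp g).of_le (((mFourier n).continuous.aestronglyMeasurable).mul
    (Lp.aestronglyMeasurable g)) (Eventually.of_forall fun t => ?_)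
  rw [norm_mul]
  refine mul_le_of_le_one_left (norm_nonneg _) ?_
  exact ((mFourier n).norm_coe_le_norm t).trans_eq mFourier_norm

/-- The Fourier coefficients of `g · conj f`, for `f, g ∈ L²`. -/
theorem hasSum_coeff_mul_conj (f g : Lp ℂ 2 (volume : Measure (UnitAddTorus (Fin d))))
    (n : Fin d → ℤ) :
    HasSum (fun k => mFourierCoeff g k * conj (mFourierCoeff f (k + n)))
      (∫ t, mFourier n t * (g t * conj (f t))) := by
  have h := hasSum_prod_mFourierCoeff f (memLp_mFourier_mul g n).toLp
  have hg : ∀ k, mFourierCoeff ((memLp_mFourier_mul g n).toLp) k = mFourierCoeff g (k - n) := by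
    intro k
    rw [← mFourierCoeff_mFourier_mul]
    refine integral_congr_ae ?_
    filter_upwards [(memLp_mFourier_mul g n).coeFn_toLp] with t ht
    rw [ht]
  have hi : ∫ t, conj (f t) * ((memLp_mFourier_mul g n).toLp) t
      = ∫ t, mFourier n t * (g t * conj (f t)) := by
    refine integral_congr_ae ?_
    filter_upwards [(memLp_mFourier_mul g n).coeFn_toLp] with t ht
    rw [ht]
    ring
  rw [hi] at h
  rw [← (Equiv.subRight n).hasSum_iff]
  refine h.congr_fun fun k => ?_
  rw [hg, mul_comm]
  simp

theorem integrable_mul_conj (f g : Lp ℂ 2 (volume : Measure (UnitAddTorus (Fin d)))) :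
    Integrable fun t => g t * conj (f t) := by
  have := L2.integrable_inner (𝕜 := ℂ) f g
  exact this

/-- A square-summable combination of orthonormal vectors converges. -/
theorem _root_.Orthonormal.summable_smul {ι H : Type*} [NormedAddCommGroup H]
    [InnerProductSpace ℂ H] [CompleteSpace H] {v : ι → H} (hv : Orthonormal ℂ v) {c : ι → ℂ}
    (hc : Summable fun i => ‖c i‖ ^ 2) : Summable fun i => c i • v i := by
  have := (hv.orthogonalFamily.summable_iff_norm_sq_summable c).2 hc
  simpa using this

/-- The function on the torus with Fourier coefficients `c`, if `c` is square-summable. -/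
def torusSum (c : (Fin d → ℤ) → ℂ) : Lp ℂ 2 (volume : Measure (UnitAddTorus (Fin d))) :=
  ∑' n, c n • mFourierLp 2 n

theorem hasSum_torusSum {c : (Fin d → ℤ) → ℂ} (hc : Summable fun n => ‖c n‖ ^ 2) :
    HasSum (fun n => c n • mFourierLp 2 n) (torusSum c) :=
  (orthonormal_mFourier.summable_smul hc).hasSum

theorem mFourierCoeff_torusSum {c : (Fin d → ℤ) → ℂ} (hc : Summable fun n => ‖c n‖ ^ 2)
    (n : Fin d → ℤ) : mFourierCoeff (torusSum c) n = c n := by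
  rw [← mFourierBasis_repr, HilbertBasis.repr_apply_apply, coe_mFourierBasis]
  have h := (innerSL ℂ (mFourierLp (d := Fin d) 2 n)).hasSum (hasSum_torusSum hc)
  refine HasSum.unique h ?_
  refine (hasSum_ite_eq n (c n)).congr_fun fun k => ?_
  change inner ℂ _ (c k • mFourierLp 2 k) = _
  rw [inner_smul_right, orthonormal_iff_ite.1 orthonormal_mFourier]
  by_cases hk : k = n
  · simp [hk]
  · simp [hk, Ne.symm hk]

end Torus

/-! ### The quotient map to the torus and Lebesgue measure -/

section Quotient

attribute [local instance] instMeasureSpaceUnitAddCircle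

open UnitAddTorus

variable {d : ℕ}

/-- The unit cube `∏ (aᵢ, aᵢ + 1]`. -/
def unitCube (a : Fin d → ℝ) : Set (Fin d → ℝ) := {x | ∀ i, x i ∈ Set.Ioc (a i) (a i + 1)}

theorem measurableSet_unitCube (a : Fin d → ℝ) : MeasurableSet (unitCube a) :=
  MeasurableSet.univ_pi' fun _ => measurableSet_Ioc

theorem measurable_coe_torus :
    Measurable fun x : Fin d → ℝ => ((fun i => (x i : UnitAddCircle)) : UnitAddTorus (Fin d)) :=
  measurable_pi_lambda _ fun i => AddCircle.measurable_mk'.comp (measurable_pi_apply i)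

theorem measurePreserving_unitCube (a : Fin d → ℝ) :
    MeasurePreserving (fun x : Fin d → ℝ => ((fun i => (x i : UnitAddCircle)) :
      UnitAddTorus (Fin d))) (volume.restrict (unitCube a)) volume := by
  refine ⟨measurable_coe_torus, Measure.ext fun s hs => ?_⟩
  have h := lintegral_preimage (s.indicator (1 : UnitAddTorus (Fin d) → ℝ≥0∞)) a
  have h1 := lintegral_indicator_one (μ := volume) hs
  have h2 := lintegral_indicator_one (μ := volume.restrict (unitCube a)) (measurable_coe_torus hs)
  rw [Measure.map_apply measurable_coe_torus hs, ← h2]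
  exact h.symm.trans h1

theorem exists_mem_unitCube (x : Fin d → ℝ) :
    ∃ z : Fin d → ℤ, x ∈ unitCube fun i => (z i : ℝ) := by
  refine ⟨fun i => ⌈x i⌉ - 1, fun i => ?_⟩
  have h1 := Int.ceil_lt_add_one (x i)
  have h2 := Int.le_ceil (x i)
  push_cast
  exact ⟨by linarith, by linarith⟩

variable (Γ : SplittingCrystalGroup d)

theorem SplittingCrystalGroup.measurable_freqCoord : Measurable Γ.freqCoord :=
  (LinearMap.continuous_of_finiteDimensional (Γ.freqCoord : E d →ₗ[ℝ] (Fin d → ℝ))).measurable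

theorem SplittingCrystalGroup.measurable_torusMap : Measurable Γ.torusMap :=
  measurable_coe_torus.comp Γ.measurable_freqCoord

theorem SplittingCrystalGroup.exists_map_freqCoord : ∃ c : ℝ≥0∞, c ≠ 0 ∧ c ≠ ∞ ∧
    Measure.map Γ.freqCoord (volume : Measure (E d)) = c • volume := by
  have : (Measure.map Γ.freqCoord (volume : Measure (E d))).IsAddHaarMeasure :=
    Γ.freqCoord.toContinuousLinearEquiv.isAddHaarMeasure_map volume
  refine ⟨_, ?_, ENNReal.coe_ne_top, Measure.isAddLeftInvariant_eq_smul
    (Measure.map Γ.freqCoord (volume : Measure (E d))) volume⟩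
  simpa using (Measure.addHaarScalarFactor_pos_of_isAddHaarMeasure _ _).ne'

/-- A subset of the torus is null if and only if its preimage is. -/
theorem SplittingCrystalGroup.ae_torusMap_iff (P : UnitAddTorus (Fin d) → Prop) :
    (∀ᵐ ω ∂(volume : Measure (E d)), P (Γ.torusMap ω)) ↔ ∀ᵐ x, P x := by
  obtain ⟨c, h0, -, hc⟩ := Γ.exists_map_freqCoord
  have hemb : MeasurableEmbedding Γ.freqCoord :=
    Γ.freqCoord.toContinuousLinearEquiv.toHomeomorph.measurableEmbedding
  have key : (∀ᵐ ω ∂(volume : Measure (E d)), P (Γ.torusMap ω)) ↔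
      ∀ᵐ y ∂(volume : Measure (Fin d → ℝ)), P fun i => (y i : UnitAddCircle) := by
    have h := hemb.ae_map_iff (μ := (volume : Measure (E d)))
      (p := fun y => P fun i => (y i : UnitAddCircle))
    rw [hc, Measure.ae_ennreal_smul_measure_iff h0] at h
    exact h.symm
  rw [key]
  constructor
  · intro h
    have h1 := ae_restrict_of_ae (s := unitCube (0 : Fin d → ℝ)) h
    rw [ae_iff] at h ⊢
    have h2 : MeasurePreserving (measurableEquivPiIoc (0 : Fin d → ℝ)) volume
      (Measure.comap Subtype.val volume) := measurePreserving_equivPiIoc 0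
    have h3 := h2.symm.measure_preimage_equiv {a | ¬P a}
    rw [← h3]
    refine ((MeasurableEmbedding.subtype_coe (measurableSet_unitCube 0)).comap_apply _ _).trans ?_
    refine measure_mono_null ?_ h
    rintro _ ⟨y, hy, rfl⟩
    exact hy
  · intro h
    have h1 : ∀ z : Fin d → ℤ, ∀ᵐ y ∂(volume.restrict (unitCube fun i => (z i : ℝ))),
        P fun i => (y i : UnitAddCircle) := fun z =>
      (measurePreserving_unitCube fun i => (z i : ℝ)).quasiMeasurePreserving.ae h
    have h2 := (ae_restrict_iUnion_iff (μ := volume)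
      (fun z : Fin d → ℤ => unitCube fun i => (z i : ℝ)) _).2 h1
    have h3 : (⋃ z : Fin d → ℤ, unitCube fun i => (z i : ℝ)) = Set.univ :=
      Set.eq_univ_of_forall fun x => Set.mem_iUnion.2 (exists_mem_unitCube x)
    rwa [h3, Measure.restrict_univ] at h2

theorem SplittingCrystalGroup.quasiMeasurePreserving_torusMap :
    Measure.QuasiMeasurePreserving Γ.torusMap (volume : Measure (E d)) volume := by
  refine ⟨Γ.measurable_torusMap, Measure.AbsolutelyContinuous.mk fun s hs h => ?_⟩
  rw [Measure.map_apply Γ.measurable_torusMap hs]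
  have := (Γ.ae_torusMap_iff fun x => x ∉ s).2 (by simpa [ae_iff] using h)
  rw [ae_iff] at this
  exact (congrArg volume (Set.ext fun _ => not_not.symm)).trans this

/-- Since a compact set meets only finitely many fundamental domains, `L²` norms on it are
controlled by `L²` norms on the torus. -/
theorem SplittingCrystalGroup.exists_map_restrict_le {K : Set (E d)} (hK : IsCompact K) :
    ∃ C : ℝ≥0∞, C ≠ ∞ ∧ Measure.map Γ.torusMap (volume.restrict K) ≤ C • volume := by
  obtain ⟨c, -, h1, hc⟩ := Γ.exists_map_freqCoord
  have hL : Continuous Γ.freqCoord :=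
    LinearMap.continuous_of_finiteDimensional (Γ.freqCoord : E d →ₗ[ℝ] (Fin d → ℝ))
  obtain ⟨R, hR⟩ := (hK.image hL).isBounded.exists_norm_le
  obtain ⟨N, hN⟩ := exists_nat_gt R
  let Z : Finset (Fin d → ℤ) := Fintype.piFinset fun _ => Finset.Icc (-(N : ℤ) - 1) N
  have hsub : ∀ ω ∈ K, ∃ z ∈ Z, Γ.freqCoord ω ∈ unitCube fun i => (z i : ℝ) := by
    intro ω hω
    obtain ⟨z, hz⟩ := exists_mem_unitCube (Γ.freqCoord ω)
    refine ⟨z, Fintype.mem_piFinset.2 fun i => Finset.mem_Icc.2 ?_, hz⟩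
    have h2 := (norm_le_pi_norm (Γ.freqCoord ω) i).trans
      (hR _ (Set.mem_image_of_mem _ hω))
    rw [Real.norm_eq_abs] at h2
    have h3 := abs_le.1 h2
    obtain ⟨h4, h5⟩ := hz i
    constructor
    · have : ((-(N : ℤ) - 1 : ℤ) : ℝ) < z i := by push_cast; linarith
      exact (Int.cast_lt.1 this).le
    · have : (z i : ℝ) < ((N : ℤ) : ℝ) := by push_cast; linarith
      exact (Int.cast_lt.1 this).le
  refine ⟨c * Z.card, ENNReal.mul_ne_top h1 (by simp), Measure.le_iff.2 fun s hs => ?_⟩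
  have hs' := measurable_coe_torus hs
  rw [Measure.map_apply Γ.measurable_torusMap hs,
    Measure.restrict_apply (Γ.measurable_torusMap hs)]
  calc volume (Γ.torusMap ⁻¹' s ∩ K)
      ≤ volume (Γ.freqCoord ⁻¹' (⋃ z ∈ Z, ((fun x : Fin d → ℝ => ((fun i => (x i :
          UnitAddCircle)) : UnitAddTorus (Fin d))) ⁻¹' s) ∩ unitCube fun i => (z i : ℝ))) := by
        refine measure_mono fun ω hω => ?_
        obtain ⟨z, hz, hzω⟩ := hsub ω hω.2
        exact Set.mem_iUnion₂.2 ⟨z, hz, hω.1, hzω⟩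
    _ = c * volume (⋃ z ∈ Z, ((fun x : Fin d → ℝ => ((fun i => (x i :
          UnitAddCircle)) : UnitAddTorus (Fin d))) ⁻¹' s) ∩ unitCube fun i => (z i : ℝ)) := by
        rw [← Measure.map_apply Γ.measurable_freqCoord, hc, Measure.smul_apply, smul_eq_mul]
        exact Finset.measurableSet_biUnion _ fun z _ => hs'.inter (measurableSet_unitCube _)
    _ ≤ c * ∑ z ∈ Z, volume (((fun x : Fin d → ℝ => ((fun i => (x i :
          UnitAddCircle)) : UnitAddTorus (Fin d))) ⁻¹' s) ∩ unitCube fun i => (z i : ℝ)) := by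
        gcongr
        exact measure_biUnion_finset_le _ _
    _ = (c * Z.card) * volume s := by
        have : ∀ z : Fin d → ℤ, volume (((fun x : Fin d → ℝ => ((fun i => (x i :
          UnitAddCircle)) : UnitAddTorus (Fin d))) ⁻¹' s) ∩ unitCube fun i => (z i : ℝ))
            = volume s := by
          intro z
          rw [← Measure.restrict_apply hs']
          exact (measurePreserving_unitCube fun i => (z i : ℝ)).measure_preimage
            hs.nullMeasurableSet
        simp only [this, Finset.sum_const, nsmul_eq_mul, mul_assoc]

end Quotient

/-! ### Fourier series with square-summable coefficients -/

section Series

attribute [local instance] instMeasureSpaceUnitAddCircle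

open UnitAddTorus

variable {d : ℕ} {Γ : SplittingCrystalGroup d}

/-- The exponential `e^{-2π i k·ω}`. -/
def latticeExp (k ω : E d) : ℂ :=
  Complex.exp (-2 * Real.pi * Complex.I * (inner ℝ k ω : ℝ))

theorem continuous_latticeExp (k : E d) : Continuous (latticeExp k) := by
  unfold latticeExp
  fun_prop

theorem norm_latticeExp (k ω : E d) : ‖latticeExp k ω‖ = 1 := by
  unfold latticeExp
  rw [show (-2 * Real.pi * Complex.I * (inner ℝ k ω : ℝ) : ℂ)
    = ((-2 * Real.pi * inner ℝ k ω : ℝ) : ℂ) * Complex.I by push_cast; ring]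
  exact Complex.norm_exp_ofReal_mul_I _

theorem latticeExp_add_left (k l ω : E d) :
    latticeExp (k + l) ω = latticeExp k ω * latticeExp l ω := by
  unfold latticeExp
  rw [← Complex.exp_add, inner_add_left]
  push_cast
  ring_nf

theorem latticeExp_add_right (k ω ω' : E d) :
    latticeExp k (ω + ω') = latticeExp k ω * latticeExp k ω' := by
  unfold latticeExp
  rw [← Complex.exp_add, inner_add_right]
  push_cast
  ring_nf

/-- The function on the torus with Fourier coefficients `c`, in the coordinates of the lattice. -/
def quotientSum (c : Γ.lattice → ℂ) : Lp ℂ 2 (volume : Measure (UnitAddTorus (Fin d))) :=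
  torusSum fun n => c (Γ.coord.symm n)

theorem summable_coord {c : Γ.lattice → ℂ} (hc : Summable fun k => ‖c k‖ ^ 2) :
    Summable fun n => ‖c (Γ.coord.symm n)‖ ^ 2 :=
  (Γ.coord.symm.toEquiv.summable_iff (f := fun k => ‖c k‖ ^ 2)).2 hc

theorem hasSum_quotientSum {c : Γ.lattice → ℂ} (hc : Summable fun k => ‖c k‖ ^ 2) :
    HasSum (fun k => c k • mFourierLp 2 (Γ.coord k)) (quotientSum c) := by
  have := (Γ.coord.toEquiv.hasSum_iff).2 (hasSum_torusSum (summable_coord hc))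
  refine this.congr_fun fun k => ?_
  simp

/-- Every square-summable family has a Fourier sum, pulled back from the torus. -/
theorem isFourierSum_quotientSum {c : Γ.lattice → ℂ} (hc : Summable fun k => ‖c k‖ ^ 2) :
    IsFourierSum c fun ω => quotientSum c (Γ.torusMap ω) := by
  refine ⟨(Lp.aestronglyMeasurable (quotientSum c)).comp_quasiMeasurePreserving
    Γ.quasiMeasurePreserving_torusMap, fun K hK => ?_⟩
  obtain ⟨C, hC, hle⟩ := Γ.exists_map_restrict_le hK
  let G : Finset Γ.lattice → UnitAddTorus (Fin d) → ℂ := fun s x =>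
    quotientSum c x - ∑ k ∈ s, c k * mFourier (Γ.coord k) x
  have hG : ∀ s, AEStronglyMeasurable (G s) volume := fun s =>
    (Lp.aestronglyMeasurable (quotientSum c)).sub
      (Continuous.aestronglyMeasurable (by fun_prop))
  have hlim : Tendsto (fun s => eLpNorm (G s) 2 volume) atTop (𝓝 0) := by
    have h1 := (Lp.tendsto_Lp_iff_tendsto_eLpNorm' _ _).1 (hasSum_quotientSum hc)
    refine h1.congr fun s => ?_
    rw [← eLpNorm_neg]
    refine eLpNorm_congr_ae ?_
    have h2 : ∀ᵐ x, ∀ k : Γ.lattice, mFourierLp 2 (Γ.coord k) x = mFourier (Γ.coord k) x :=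
      ae_all_iff.2 fun k => coeFn_mFourierLp 2 _
    have h3 : ∀ᵐ x, (∑ k ∈ s, c k • mFourierLp 2 (Γ.coord k) : Lp ℂ 2
        (volume : Measure (UnitAddTorus (Fin d)))) x
          = ∑ k ∈ s, c k * mFourierLp 2 (Γ.coord k) x := by
      have h4 := Lp.coeFn_finsetSum s fun k => c k • mFourierLp 2 (Γ.coord k)
      have h5 : ∀ᵐ x, ∀ k : Γ.lattice, (c k • mFourierLp 2 (Γ.coord k) : Lp ℂ 2
          (volume : Measure (UnitAddTorus (Fin d)))) x = c k * mFourierLp 2 (Γ.coord k) x :=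
        ae_all_iff.2 fun k => Lp.coeFn_smul _ _
      filter_upwards [h4, h5] with x h4 h5
      rw [h4, Finset.sum_apply]
      exact Finset.sum_congr rfl fun k _ => h5 k
    filter_upwards [h2, h3] with x h2 h3
    simp only [Pi.neg_apply, Pi.sub_apply, neg_sub, G]
    rw [h3]
    simp only [h2]
  have hbd : ∀ s, eLpNorm (fun ω => G s (Γ.torusMap ω)) 2 (volume.restrict K)
      ≤ C ^ (1 / (2 : ℝ≥0∞).toReal) * eLpNorm (G s) 2 volume := by
    intro s
    have hac : Measure.map Γ.torusMap (volume.restrict K) ≪ volume :=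
      (Measure.absolutelyContinuous_of_le hle).trans Measure.smul_absolutelyContinuous
    have h1 := eLpNorm_map_measure (p := 2) (μ := volume.restrict K) ((hG s).mono_ac hac)
      Γ.measurable_torusMap.aemeasurable
    calc _ = eLpNorm (G s) 2 (Measure.map Γ.torusMap (volume.restrict K)) := h1.symm
      _ ≤ eLpNorm (G s) 2 (C • volume) := eLpNorm_mono_measure _ hle
      _ = _ := by
        rw [eLpNorm_smul_measure_of_ne_top (by simp), smul_eq_mul, ENNReal.toReal_div]
        simp
  refine tendsto_of_tendsto_of_tendsto_of_le_of_le tendsto_const_nhds ?_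
    (fun s => zero_le) (fun s => (le_of_eq ?_).trans (hbd s))
  · have := ENNReal.Tendsto.const_mul (a := C ^ (1 / (2 : ℝ≥0∞).toReal)) hlim
      (Or.inr (ENNReal.rpow_ne_top_of_nonneg (by simp) hC))
    simpa using this
  · refine congrArg (fun f => eLpNorm f 2 (volume.restrict K)) (funext fun ω => ?_)
    simp only [G, Γ.exp_eq_mFourier]

/-- The coefficients of a Fourier series determine its sum almost everywhere. -/
theorem IsFourierSum.ae_eq {c : Γ.lattice → ℂ} {f f' : E d → ℂ} (h : IsFourierSum c f)
    (h' : IsFourierSum c f') : f =ᵐ[volume] f' := by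
  have key : ∀ n : ℕ, f =ᵐ[volume.restrict (Metric.closedBall (0 : E d) n)] f' := by
    intro n
    have hK := isCompact_closedBall (0 : E d) n
    have h1 := (h.2 _ hK).add (h'.2 _ hK)
    rw [add_zero] at h1
    have hm := h.1.restrict (s := Metric.closedBall (0 : E d) n)
    have hm' := h'.1.restrict (s := Metric.closedBall (0 : E d) n)
    have h2 : eLpNorm (f - f') 2 (volume.restrict (Metric.closedBall (0 : E d) n)) ≤ 0 := by
      refine ge_of_tendsto h1 (Eventually.of_forall fun s => ?_)
      have hc : AEStronglyMeasurable (fun ω => ∑ k ∈ s, c k * Complex.exp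
          (-2 * Real.pi * Complex.I * (inner ℝ (k : E d) ω : ℝ)))
          (volume.restrict (Metric.closedBall (0 : E d) n)) :=
        Continuous.aestronglyMeasurable (by fun_prop)
      refine le_trans (le_of_eq ?_) (eLpNorm_sub_le (hm.sub hc) (hm'.sub hc) (by norm_num))
      congr 1
      funext ω
      simp
    have h3 := (eLpNorm_eq_zero_iff (hm.sub hm') (by simp)).1 (le_antisymm h2 (zero_le))
    filter_upwards [h3] with ω hω
    exact sub_eq_zero.1 hω
  have := (ae_restrict_iUnion_iff (μ := volume)
    (fun n : ℕ => Metric.closedBall (0 : E d) n) _).2 key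
  rwa [Metric.iUnion_closedBall_nat, Measure.restrict_univ] at this

theorem isFourierSum_fourierSum {c : Γ.lattice → ℂ} (hc : Summable fun k => ‖c k‖ ^ 2) :
    IsFourierSum c (fourierSum c) :=
  Classical.epsilon_spec ⟨_, isFourierSum_quotientSum hc⟩

theorem fourierSum_ae_eq {c : Γ.lattice → ℂ} (hc : Summable fun k => ‖c k‖ ^ 2) :
    fourierSum c =ᵐ[volume] fun ω => quotientSum c (Γ.torusMap ω) :=
  (isFourierSum_fourierSum hc).ae_eq (isFourierSum_quotientSum hc)

theorem IsFourierSum.sum {ι : Type*} {s : Finset ι} {c : ι → Γ.lattice → ℂ} {f : ι → E d → ℂ}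
    (h : ∀ i ∈ s, IsFourierSum (c i) (f i)) :
    IsFourierSum (fun k => ∑ i ∈ s, c i k) (fun ω => ∑ i ∈ s, f i ω) := by
  refine ⟨Finset.aestronglyMeasurable_fun_sum s fun i hi => (h i hi).1, fun K hK => ?_⟩
  have h1 := tendsto_finsetSum s fun i hi => (h i hi).2 K hK
  rw [Finset.sum_const_zero] at h1
  refine tendsto_of_tendsto_of_tendsto_of_le_of_le tendsto_const_nhds h1
    (fun _ => zero_le) (fun S => ?_)
  refine le_trans (le_of_eq ?_) (eLpNorm_sum_le (fun i hi => ?_) (by norm_num))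
  · congr 1
    funext ω
    rw [Finset.sum_apply, Finset.sum_sub_distrib]
    congr 1
    rw [Finset.sum_comm]
    exact Finset.sum_congr rfl fun k _ => Finset.sum_mul _ _ _
  · exact (h i hi).1.restrict.sub (Continuous.aestronglyMeasurable (by fun_prop))

theorem IsFourierSum.const_mul {c : Γ.lattice → ℂ} {f : E d → ℂ} (h : IsFourierSum c f) (z : ℂ) :
    IsFourierSum (fun k => z * c k) (fun ω => z * f ω) := by
  refine ⟨h.1.const_mul z, fun K hK => ?_⟩
  have h1 := ENNReal.Tendsto.const_mul (a := ‖z‖ₑ) (h.2 K hK) (Or.inr enorm_ne_top)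
  rw [mul_zero] at h1
  refine h1.congr fun s => ?_
  rw [← eLpNorm_const_smul]
  congr 1
  funext ω
  simp only [Pi.smul_apply, smul_eq_mul, mul_sub, Finset.mul_sum, mul_assoc]

end Series

/-! ### Polyphase decomposition -/

section Polyphase

variable {d m : ℕ} {Γ : SplittingCrystalGroup d} (a : AdmissibleMatrix Γ)

/-- The dual dilation `ω ↦ a* ω`. -/
def AdmissibleMatrix.dual : E d →ₗ[ℝ] E d := LinearMap.adjoint (a.lin : E d →ₗ[ℝ] E d)

theorem AdmissibleMatrix.onLattice_sub (k l : Γ.lattice) :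
    a.onLattice (k - l) = a.onLattice k - a.onLattice l :=
  Subtype.ext (map_sub a.lin (k : E d) l)

theorem AdmissibleMatrix.onLattice_zero : a.onLattice 0 = 0 :=
  Subtype.ext (map_zero a.lin)

theorem AdmissibleMatrix.onLattice_injective : Function.Injective a.onLattice := fun _ _ h =>
  Subtype.ext (a.lin.injective (congrArg Subtype.val h))

theorem AdmissibleMatrix.dual_det_ne_zero : LinearMap.det a.dual ≠ 0 := by
  have h1 : a.dual * LinearMap.adjoint (a.lin.symm : E d →ₗ[ℝ] E d) = 1 := by
    rw [Module.End.mul_eq_comp, AdmissibleMatrix.dual, ← LinearMap.adjoint_comp]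
    have : (a.lin.symm : E d →ₗ[ℝ] E d) ∘ₗ (a.lin : E d →ₗ[ℝ] E d) = LinearMap.id := by
      ext x; simp
    rw [this, LinearMap.adjoint_id]
    rfl
  have h2 := congrArg LinearMap.det h1
  rw [map_mul, map_one] at h2
  exact left_ne_zero_of_mul_eq_one h2

theorem AdmissibleMatrix.dual_adjoint_symm (x : E d) :
    a.dual (LinearMap.adjoint (a.lin.symm : E d →ₗ[ℝ] E d) x) = x := by
  refine ext_inner_right ℝ fun y => ?_
  rw [AdmissibleMatrix.dual, LinearMap.adjoint_inner_left, LinearMap.adjoint_inner_left]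
  simp

theorem AdmissibleMatrix.exists_map_dual : ∃ C : ℝ≥0∞, C ≠ 0 ∧ C ≠ ∞ ∧
    Measure.map a.dual (volume : Measure (E d)) = C • volume := by
  refine ⟨_, ?_, ENNReal.ofReal_ne_top,
    Measure.map_linearMap_addHaar_eq_smul_addHaar volume a.dual_det_ne_zero⟩
  simpa using a.dual_det_ne_zero

theorem AdmissibleMatrix.continuous_dual : Continuous a.dual :=
  LinearMap.continuous_of_finiteDimensional _

theorem AdmissibleMatrix.dual_surjective : Function.Surjective a.dual := fun x =>
  ⟨_, a.dual_adjoint_symm x⟩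

theorem AdmissibleMatrix.dual_injective : Function.Injective a.dual :=
  LinearMap.injective_iff_surjective.2 a.dual_surjective

theorem AdmissibleMatrix.measurableEmbedding_dual : MeasurableEmbedding a.dual :=
  (LinearEquiv.ofBijective a.dual
    ⟨a.dual_injective, a.dual_surjective⟩).toContinuousLinearEquiv.toHomeomorph.measurableEmbedding

theorem AdmissibleMatrix.ae_dual_iff (P : E d → Prop) :
    (∀ᵐ ω ∂(volume : Measure (E d)), P (a.dual ω)) ↔ ∀ᵐ ω ∂(volume : Measure (E d)), P ω := by
  obtain ⟨C, h0, -, hC⟩ := a.exists_map_dual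
  rw [← a.measurableEmbedding_dual.ae_map_iff, hC, Measure.ae_ennreal_smul_measure_iff h0]

theorem AdmissibleMatrix.latticeExp_onLattice (k : Γ.lattice) (ω : E d) :
    latticeExp (a.onLattice k) ω = latticeExp k (a.dual ω) := by
  unfold latticeExp AdmissibleMatrix.dual
  rw [LinearMap.adjoint_inner_right]
  rfl

/-- The function `ω ↦ e^{-2π i t·ω} f(a* ω)` has the Fourier coefficients of `f`, placed on the
coset `a Λ + t`. -/
theorem IsFourierSum.dilate {c : Γ.lattice → ℂ} {f : E d → ℂ} (h : IsFourierSum c f)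
    (t : Γ.lattice) :
    IsFourierSum (Function.extend (fun l => a.onLattice l + t) c 0)
      (fun ω => latticeExp t ω * f (a.dual ω)) := by
  obtain ⟨C, hC0, hC, hmap⟩ := a.exists_map_dual
  have hj : Function.Injective fun l : Γ.lattice => a.onLattice l + t :=
    (add_left_injective t).comp a.onLattice_injective
  have hqm : Measure.QuasiMeasurePreserving a.dual (volume : Measure (E d)) volume :=
    ⟨a.continuous_dual.measurable, by rw [hmap]; exact Measure.smul_absolutelyContinuous⟩
  have hfm : AEStronglyMeasurable (fun ω => f (a.dual ω)) volume :=
    h.1.comp_quasiMeasurePreserving hqm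
  refine ⟨(continuous_latticeExp _).aestronglyMeasurable.mul hfm, fun K hK => ?_⟩
  have hK' := hK.image a.continuous_dual
  have hpre : Tendsto (fun S : Finset Γ.lattice => S.preimage _ hj.injOn) atTop atTop := by
    refine tendsto_atTop.2 fun T => ?_
    filter_upwards [eventually_ge_atTop (T.map ⟨_, hj⟩)] with S hS
    intro l hl
    rw [Finset.mem_preimage]
    exact hS (Finset.mem_map_of_mem ⟨_, hj⟩ hl)
  have h1 := (h.2 _ hK').comp hpre
  have h2 := ENNReal.Tendsto.const_mul (a := C ^ (1 / 2 : ℝ)) h1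
    (Or.inr (ENNReal.rpow_ne_top_of_nonneg (by norm_num) hC))
  rw [mul_zero] at h2
  refine h2.congr fun S => ?_
  set T := S.preimage _ hj.injOn with hT
  let G : E d → ℂ := fun ω => f ω - ∑ k ∈ T, c k * latticeExp k ω
  have hG : AEStronglyMeasurable G volume := h.1.sub (Continuous.aestronglyMeasurable
    (continuous_finsetSum _ fun k _ => continuous_const.mul (continuous_latticeExp _)))
  -- Change of variables `ω ↦ a* ω` from `K` to `a* K`.
  have e1 : Measure.map a.dual (volume.restrict K) = C • volume.restrict (a.dual '' K) := by
    rw [← Measure.restrict_smul, ← hmap, a.measurableEmbedding_dual.restrict_map,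
      Set.preimage_image_eq _ a.dual_injective]
  have hGm : AEStronglyMeasurable G (Measure.map a.dual (volume.restrict K)) := by
    rw [e1]
    exact (hG.restrict).mono_ac Measure.smul_absolutelyContinuous
  have h3 := eLpNorm_map_measure (p := 2) (μ := volume.restrict K) hGm
    a.continuous_dual.measurable.aemeasurable
  rw [e1, eLpNorm_smul_measure_of_ne_top (by simp), smul_eq_mul, ENNReal.toReal_div] at h3
  simp only [ENNReal.toReal_one, ENNReal.toReal_ofNat] at h3
  change C ^ (1 / 2 : ℝ) * eLpNorm G 2 _ = _
  rw [h3]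
  refine eLpNorm_congr_norm_ae (Eventually.of_forall fun ω => ?_)
  have e2 : ∑ k ∈ S, Function.extend (fun l => a.onLattice l + t) c 0 k * latticeExp k ω
      = latticeExp t ω * ∑ k ∈ T, c k * latticeExp k (a.dual ω) := by
    rw [Finset.mul_sum]
    have := Finset.sum_preimage (fun l : Γ.lattice => a.onLattice l + t) S hj.injOn
      (fun k => Function.extend (fun l => a.onLattice l + t) c 0 k * latticeExp k ω)
      (fun k _ hk => by rw [Function.extend_apply' _ _ _ (by simpa using hk)]; simp)
    rw [← this]
    refine Finset.sum_congr rfl fun k _ => ?_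
    rw [hj.extend_apply, AddSubgroup.coe_add, latticeExp_add_left, a.latticeExp_onLattice]
    ring
  change ‖G (a.dual ω)‖ = ‖latticeExp t ω * f (a.dual ω) -
    ∑ k ∈ S, Function.extend (fun l => a.onLattice l + t) c 0 k * latticeExp k ω‖
  rw [e2, ← mul_sub, norm_mul, norm_latticeExp, one_mul]

variable {t : Fin m → Γ.lattice}

/-- The bijection `(s, l) ↦ a l + t_s` given by representatives `t_s` of `Λ / a Λ`. -/
def cosetEquiv (ht : IsCosetReps Γ.lattice (a.lin : E d →ₗ[ℝ] E d) t) :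
    Fin m × Γ.lattice ≃ Γ.lattice :=
  Equiv.ofBijective (fun p => a.onLattice p.2 + t p.1) <| by
    constructor
    · rintro ⟨s, l⟩ ⟨s', l'⟩ h
      have hs : s = s' := (ht (a.onLattice l + t s)).unique ⟨l, rfl⟩
        ⟨l', by have := congrArg Subtype.val h; exact this⟩
      subst hs
      have := a.onLattice_injective (add_right_cancel h)
      exact Prod.ext rfl this
    · intro k
      obtain ⟨s, ⟨l, hl⟩, -⟩ := ht k
      exact ⟨(s, l), Subtype.ext hl.symm⟩

theorem cosetEquiv_apply (ht : IsCosetReps Γ.lattice (a.lin : E d →ₗ[ℝ] E d) t) (s : Fin m)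
    (l : Γ.lattice) : cosetEquiv a ht (s, l) = a.onLattice l + t s := rfl

/-- The Fourier series of `c` splits into the series over the cosets of `a Λ`. -/
theorem fourierSum_polyphase (ht : IsCosetReps Γ.lattice (a.lin : E d →ₗ[ℝ] E d) t)
    {c : Γ.lattice → ℂ} (hc : Summable fun k => ‖c k‖ ^ 2) :
    fourierSum c =ᵐ[volume] fun ω => ∑ s, latticeExp (t s) ω *
      fourierSum (fun l => c (a.onLattice l + t s)) (a.dual ω) := by
  have hsum : ∀ s, Summable fun l => ‖c (a.onLattice l + t s)‖ ^ 2 := fun s =>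
    hc.comp_injective (i := fun l : Γ.lattice => a.onLattice l + t s)
      ((add_left_injective (t s)).comp a.onLattice_injective)
  have h := IsFourierSum.sum (s := Finset.univ) fun s _ =>
    (isFourierSum_fourierSum (hsum s)).dilate a (t s)
  refine (isFourierSum_fourierSum hc).ae_eq ?_
  convert h using 1
  funext k
  obtain ⟨⟨s, l⟩, rfl⟩ := (cosetEquiv a ht).surjective k
  rw [cosetEquiv_apply, Finset.sum_eq_single s]
  · exact (((add_left_injective (t s)).comp a.onLattice_injective).extend_apply
      (fun l => c (a.onLattice l + t s)) 0 l).symm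
  · intro s' _ hs'
    refine Function.extend_apply' _ _ _ ?_
    rintro ⟨l', hl'⟩
    exact hs' (congrArg Prod.fst ((cosetEquiv a ht).injective hl' :
      ((s', l') : Fin m × Γ.lattice) = (s, l)))
  · simp

end Polyphase

/-! ### The matrix `𝒰` and discrete orthogonality -/

section MatU

attribute [local instance] instMeasureSpaceUnitAddCircle

open UnitAddTorus ComplexConjugate

variable {d m : ℕ} {Γ : SplittingCrystalGroup d} (a : AdmissibleMatrix Γ)
  {t : Fin m → Γ.lattice}

theorem hasSum_prod_of_fintype {α β M : Type*} [Fintype α] [AddCommMonoid M] [TopologicalSpace M]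
    [ContinuousAdd M] {f : α × β → M} {x : α → M} (h : ∀ s, HasSum (fun b => f (s, b)) (x s)) :
    HasSum f (∑ s, x s) := by
  classical
  have h1 : ∀ s, HasSum (fun p : α × β => if p.1 = s then f p else 0) (x s) := by
    intro s
    refine (Function.Injective.hasSum_iff (Prod.mk_right_injective s) ?_).1 ?_
    · rintro ⟨s', b⟩ hb
      exact if_neg fun hs => hb ⟨b, by simp [← hs]⟩
    · refine (h s).congr_fun fun b => ?_
      simp
  refine (hasSum_sum fun s (_ : s ∈ Finset.univ) => h1 s).congr_fun fun p => ?_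
  simp

theorem integral_mFourier (n : Fin d → ℤ) :
    ∫ x, mFourier n x = if n = 0 then (1 : ℂ) else 0 := by
  have h := orthonormal_iff_ite.1 (orthonormal_mFourier (d := Fin d)) 0 n
  simp only [mFourierLp, ContinuousMap.inner_toLp, ← mFourier_neg, ← mFourier_add] at h
  simpa [eq_comm] using h

theorem mFourierCoeff_quotientSum {c : Γ.lattice → ℂ} (hc : Summable fun k => ‖c k‖ ^ 2)
    (n : Fin d → ℤ) : mFourierCoeff (quotientSum c) n = c (Γ.coord.symm n) :=
  mFourierCoeff_torusSum (summable_coord hc) n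

/-- The Fourier coefficients of `f · conj g`, for `f` and `g` with square-summable Fourier
coefficients. -/
theorem hasSum_quotientSum_mul_conj {c c' : Γ.lattice → ℂ} (hc : Summable fun k => ‖c k‖ ^ 2)
    (hc' : Summable fun k => ‖c' k‖ ^ 2) (v : Γ.lattice) :
    HasSum (fun k => c k * conj (c' (k - v)))
      (∫ x, mFourier (-Γ.coord v) x * (quotientSum c x * conj (quotientSum c' x))) := by
  have h := hasSum_coeff_mul_conj (quotientSum c') (quotientSum c) (-Γ.coord v)
  rw [← Γ.coord.toEquiv.hasSum_iff] at h
  refine h.congr_fun fun k => ?_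
  rw [Function.comp_apply, mFourierCoeff_quotientSum hc, mFourierCoeff_quotientSum hc',
    ← sub_eq_add_neg]
  simp [← map_sub]

/-- The matrix function on the torus from which `𝒰` is pulled back. -/
def torusMatU (t : Fin m → Γ.lattice)
    (c : Fin m → Γ.lattice → Matrix Γ.pointGroup Γ.pointGroup ℂ) (x : UnitAddTorus (Fin d)) :
    Matrix (Fin m × Γ.pointGroup) (Fin m × Γ.pointGroup) ℂ :=
  Matrix.of fun p q => quotientSum
    (fun k => ((1 / Real.sqrt m : ℝ) : ℂ) * c p.1 (a.onLattice k + t q.1) p.2 q.2) x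

theorem summable_const_mul_sq {ι : Type*} {c : ι → ℂ} (hc : Summable fun k => ‖c k‖ ^ 2) (z : ℂ) :
    Summable fun k => ‖z * c k‖ ^ 2 := by
  simp only [norm_mul, mul_pow]
  exact hc.mul_left _

theorem summable_coset {c : Γ.lattice → Matrix Γ.pointGroup Γ.pointGroup ℂ}
    (hc : SquareSummable c) (s : Γ.lattice) (g g' : Γ.pointGroup) (z : ℂ) :
    Summable fun k => ‖z * c (a.onLattice k + s) g g'‖ ^ 2 :=
  summable_const_mul_sq ((hc g g').comp_injective (i := fun l : Γ.lattice => a.onLattice l + s)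
      ((add_left_injective s).comp a.onLattice_injective)) z

theorem matU_ae_eq (t : Fin m → Γ.lattice)
    {c : Fin m → Γ.lattice → Matrix Γ.pointGroup Γ.pointGroup ℂ} (hc : ∀ i, SquareSummable (c i)) :
    matU a t c =ᵐ[volume] fun ω => torusMatU a t c (Γ.torusMap ω) := by
  have h : ∀ᵐ ω ∂(volume : Measure (E d)), ∀ p q, matU a t c ω p q
      = torusMatU a t c (Γ.torusMap ω) p q := by
    rw [ae_all_iff]
    intro p
    rw [ae_all_iff]
    intro q
    exact fourierSum_ae_eq (summable_coset a (hc p.1) (t q.1) p.2 q.2 _)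
  filter_upwards [h] with ω hω
  exact Matrix.ext hω

theorem unitaryAE_matU_iff_torus (t : Fin m → Γ.lattice)
    {c : Fin m → Γ.lattice → Matrix Γ.pointGroup Γ.pointGroup ℂ} (hc : ∀ i, SquareSummable (c i)) :
    UnitaryAE (matU a t c) ↔ ∀ᵐ x, torusMatU a t c x ∈ Matrix.unitaryGroup _ ℂ := by
  rw [← Γ.ae_torusMap_iff]
  refine eventually_congr ?_
  filter_upwards [matU_ae_eq a t hc] with ω hω
  rw [hω]

theorem inv_sqrt_mul_inv_sqrt (m : ℕ) :
    ((1 / Real.sqrt m : ℝ) : ℂ) * ((1 / Real.sqrt m : ℝ) : ℂ) = 1 / (m : ℂ) := by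
  rw [← Complex.ofReal_mul, div_mul_div_comm, Real.mul_self_sqrt (Nat.cast_nonneg m)]
  simp

/-- The entries of `𝒰 𝒰*` have the sums of discrete orthogonality as Fourier coefficients. -/
theorem hasSum_matU_coeff (ht : IsCosetReps Γ.lattice (a.lin : E d →ₗ[ℝ] E d) t)
    {c : Fin m → Γ.lattice → Matrix Γ.pointGroup Γ.pointGroup ℂ} (hc : ∀ i, SquareSummable (c i))
    (v : Γ.lattice) (p q : Fin m × Γ.pointGroup) :
    HasSum (fun k => ((1 / (m : ℂ)) • (c p.1 k * (c q.1 (k - a.onLattice v)).conjTranspose))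
        p.2 q.2)
      (∫ x, mFourier (-Γ.coord v) x * ((torusMatU a t c x * star (torusMatU a t c x)) p q)) := by
  have h1 : ∀ r : Fin m × Γ.pointGroup, HasSum (fun l : Γ.lattice =>
      (1 / (m : ℂ)) * (c p.1 (a.onLattice l + t r.1) p.2 r.2 *
        conj (c q.1 (a.onLattice l + t r.1 - a.onLattice v) q.2 r.2)))
      (∫ x, mFourier (-Γ.coord v) x * (torusMatU a t c x p r * conj (torusMatU a t c x q r))) := by
    intro r
    have := hasSum_quotientSum_mul_conj
      (summable_coset a (hc p.1) (t r.1) p.2 r.2 ((1 / Real.sqrt m : ℝ) : ℂ))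
      (summable_coset a (hc q.1) (t r.1) q.2 r.2 ((1 / Real.sqrt m : ℝ) : ℂ)) v
    refine this.congr_fun fun l => ?_
    rw [← inv_sqrt_mul_inv_sqrt, map_mul, Complex.conj_ofReal, a.onLattice_sub, sub_add_eq_add_sub]
    ring
  have h2 := fun s : Fin m => hasSum_sum fun g (_ : g ∈ Finset.univ) => h1 (s, g)
  have h3 := hasSum_prod_of_fintype (f := fun y : Fin m × Γ.lattice =>
    ∑ g, (1 / (m : ℂ)) * (c p.1 (cosetEquiv a ht y) p.2 g *
        conj (c q.1 (cosetEquiv a ht y - a.onLattice v) q.2 g))) h2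
  have h4 := (cosetEquiv a ht).hasSum_iff (f := fun k =>
    ∑ g, (1 / (m : ℂ)) * (c p.1 k p.2 g * conj (c q.1 (k - a.onLattice v) q.2 g))) |>.1 h3
  have e : ∑ s, ∑ g, ∫ x, mFourier (-Γ.coord v) x *
      (torusMatU a t c x p (s, g) * conj (torusMatU a t c x q (s, g)))
      = ∫ x, mFourier (-Γ.coord v) x * ((torusMatU a t c x * star (torusMatU a t c x)) p q) := by
    rw [← Fintype.sum_prod_type' (f := fun s g => ∫ x, mFourier (-Γ.coord v) x *
      (torusMatU a t c x p (s, g) * conj (torusMatU a t c x q (s, g)))), ← integral_finsetSum]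
    · refine integral_congr_ae (Eventually.of_forall fun x => ?_)
      simp only [Matrix.mul_apply, Matrix.star_apply, Finset.mul_sum]
      rfl
    · intro r _
      exact (integrable_mul_conj _ _).bdd_mul (mFourier _).continuous.aestronglyMeasurable
        (Eventually.of_forall fun x => (mFourier _).norm_coe_le_norm x)
  rw [e] at h4
  refine h4.congr_fun fun k => ?_
  simp [Matrix.mul_apply, Finset.mul_sum]

theorem discreteOrthogonality_iff {c : Fin m → Γ.lattice → Matrix Γ.pointGroup Γ.pointGroup ℂ} :
    DiscreteOrthogonality a c ↔ ∀ (v : Γ.lattice) (p q : Fin m × Γ.pointGroup),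
      HasSum (fun k => ((1 / (m : ℂ)) • (c p.1 k * (c q.1 (k - a.onLattice v)).conjTranspose))
        p.2 q.2) (open Classical in if v = 0 ∧ p = q then 1 else 0) := by
  classical
  have e : ∀ (v : Γ.lattice) (i j : Fin m) (g h : Γ.pointGroup),
      (if v = 0 ∧ i = j then (1 : Matrix Γ.pointGroup Γ.pointGroup ℂ) else 0) g h
        = if v = 0 ∧ ((i, g) : Fin m × Γ.pointGroup) = (j, h) then 1 else 0 := by
    intro v i j g h
    by_cases h1 : v = 0 ∧ i = j
    · rw [if_pos h1, Matrix.one_apply]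
      simp [h1.1, h1.2]
    · rw [if_neg h1, if_neg]
      · rfl
      · rintro ⟨h2, h3⟩
        exact h1 ⟨h2, congrArg Prod.fst h3⟩
  constructor
  · rintro h v ⟨i, g⟩ ⟨j, h'⟩
    have h1 := Pi.hasSum.1 (Pi.hasSum.1 (h v i j) g) h'
    convert h1 using 1
    convert (e v i j g h').symm
  · intro h v i j
    refine Pi.hasSum.2 fun g => Pi.hasSum.2 fun h' => ?_
    convert h v (i, g) (j, h') using 1
    convert e v i j g h'

/-- Unitarity of `𝒰` is equivalent to discrete orthogonality, without any symmetry. -/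
theorem unitaryAE_matU_iff (ht : IsCosetReps Γ.lattice (a.lin : E d →ₗ[ℝ] E d) t)
    {c : Fin m → Γ.lattice → Matrix Γ.pointGroup Γ.pointGroup ℂ} (hc : ∀ i, SquareSummable (c i)) :
    UnitaryAE (matU a t c) ↔ DiscreteOrthogonality a c := by
  classical
  rw [unitaryAE_matU_iff_torus a t hc, discreteOrthogonality_iff]
  have h1 : (∀ᵐ x, torusMatU a t c x ∈ Matrix.unitaryGroup _ ℂ) ↔ ∀ p q, ∀ᵐ x,
      (torusMatU a t c x * star (torusMatU a t c x)) p q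
        = (1 : Matrix (Fin m × Γ.pointGroup) (Fin m × Γ.pointGroup) ℂ) p q := by
    simp only [Matrix.mem_unitaryGroup_iff, ← Matrix.ext_iff, ae_all_iff]
  rw [h1]
  have hint : ∀ p q, Integrable fun x => (torusMatU a t c x * star (torusMatU a t c x)) p q := by
    intro p q
    simp only [Matrix.mul_apply, Matrix.star_apply]
    exact integrable_finsetSum _ fun r _ => integrable_mul_conj _ _
  have hone : ∀ (v : Γ.lattice) (p q : Fin m × Γ.pointGroup),
      ∫ x, mFourier (-Γ.coord v) x *
        (1 : Matrix (Fin m × Γ.pointGroup) (Fin m × Γ.pointGroup) ℂ) p q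
        = if v = 0 ∧ p = q then 1 else 0 := by
    intro v p q
    rw [integral_mul_const, integral_mFourier, Matrix.one_apply]
    by_cases h2 : v = 0 <;> by_cases h3 : p = q <;> simp [h2, h3]
  constructor
  · intro h v p q
    have h2 := hasSum_matU_coeff a ht hc v p q
    rw [integral_congr_ae (g := fun x => mFourier (-Γ.coord v) x *
        (1 : Matrix (Fin m × Γ.pointGroup) (Fin m × Γ.pointGroup) ℂ) p q), hone] at h2
    · convert h2
    · filter_upwards [h p q] with x hx
      rw [hx]
  · intro h p q
    have h3 := ae_eq_zero_of_integral_mFourier_eq_zero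
      ((hint p q).sub (integrable_const
        ((1 : Matrix (Fin m × Γ.pointGroup) (Fin m × Γ.pointGroup) ℂ) p q))) (fun n => by
        obtain ⟨v, rfl⟩ : ∃ v, n = -Γ.coord v := ⟨Γ.coord.symm (-n), by simp⟩
        have h4 := (hasSum_matU_coeff a ht hc v p q).unique (h v p q)
        have h5 := hone v p q
        simp only [Pi.sub_apply, mul_sub]
        rw [integral_sub, h4, h5]
        · convert sub_self _
        · exact (hint p q).bdd_mul (mFourier _).continuous.aestronglyMeasurable
            (Eventually.of_forall fun x => (mFourier _).norm_coe_le_norm x)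
        · exact (integrable_const _).bdd_mul (mFourier _).continuous.aestronglyMeasurable
            (Eventually.of_forall fun x => (mFourier _).norm_coe_le_norm x))
    filter_upwards [h3] with x hx
    exact sub_eq_zero.1 hx

end MatU

/-! ### The matrix `ℳ` -/

section MatM

open ComplexConjugate

variable {d m : ℕ} {Γ : SplittingCrystalGroup d} (a : AdmissibleMatrix Γ)
  {t : Fin m → Γ.lattice}

theorem latticeExp_eq_one_iff (k ω : E d) :
    latticeExp k ω = 1 ↔ ∃ z : ℤ, inner ℝ k ω = (z : ℝ) := by
  unfold latticeExp
  rw [Complex.exp_eq_one_iff]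
  have h0 : (2 * Real.pi * Complex.I : ℂ) ≠ 0 := by simp [Real.pi_ne_zero]
  constructor
  · rintro ⟨n, hn⟩
    refine ⟨-n, ?_⟩
    have h1 : ((inner ℝ k ω : ℝ) : ℂ) = -(n : ℂ) := by
      apply mul_left_cancel₀ h0
      linear_combination -hn
    exact_mod_cast h1
  · rintro ⟨z, hz⟩
    refine ⟨-z, ?_⟩
    rw [hz]
    push_cast
    ring

theorem conj_latticeExp (k ω : E d) : conj (latticeExp k ω) = latticeExp k (-ω) := by
  unfold latticeExp
  rw [← Complex.exp_conj]
  simp [map_ofNat]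

theorem latticeExp_dualLattice (k : Γ.lattice) (ϱ : Γ.dualLattice) :
    latticeExp (k : E d) ϱ = 1 :=
  (latticeExp_eq_one_iff _ _).2 (ϱ.2 k k.2)

/-- Orthogonality of the characters of `Λ / a Λ`. -/
theorem sum_latticeExp (ht : IsCosetReps Γ.lattice (a.lin : E d →ₗ[ℝ] E d) t) (σ : E d)
    (ϱ : Γ.dualLattice) (hσ : a.dual σ = ϱ) (hne : σ ∉ Γ.dualLattice) :
    ∑ s, latticeExp (t s) σ = 0 := by
  obtain ⟨k, hk⟩ : ∃ k : Γ.lattice, latticeExp (k : E d) σ ≠ 1 := by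
    by_contra hcon
    push Not at hcon
    exact hne fun k hk => (latticeExp_eq_one_iff _ _).1 (hcon ⟨k, hk⟩)
  -- Translation by `k` permutes the cosets and multiplies the sum by a factor different from `1`.
  have hinv : ∀ (l : Γ.lattice), latticeExp (a.onLattice l : E d) σ = 1 := fun l => by
    rw [a.latticeExp_onLattice, hσ, latticeExp_dualLattice]
  let f : Fin m → Fin m := fun s => ((cosetEquiv a ht).symm (t s + k)).1
  let l : Fin m → Γ.lattice := fun s => ((cosetEquiv a ht).symm (t s + k)).2
  have hf : ∀ s, a.onLattice (l s) + t (f s) = t s + k := fun s =>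
    (cosetEquiv a ht).apply_symm_apply (t s + k)
  have hinj : Function.Injective f := by
    intro s s' hs
    have h1 := hf s
    have h2 := hf s'
    rw [← hs] at h2
    have h3 : t s = a.onLattice (l s - l s') + t s' := by
      rw [a.onLattice_sub]
      have h4 : t s - t s' = a.onLattice (l s) - a.onLattice (l s') := by
        rw [← add_sub_add_right_eq_sub (t s) (t s') k, ← h1, ← h2, add_sub_add_right_eq_sub]
      rw [← h4, sub_add_cancel]
    exact (ht (t s)).unique ⟨0, by simp⟩ ⟨l s - l s', congrArg Subtype.val h3⟩
  have hbij : Function.Bijective f := Finite.injective_iff_bijective.1 hinj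
  have h1 : (∑ s, latticeExp (t s) σ) * latticeExp (k : E d) σ = ∑ s, latticeExp (t s) σ := by
    rw [Finset.sum_mul, ← hbij.sum_comp fun s => latticeExp (t s : E d) σ]
    refine Finset.sum_congr rfl fun s _ => ?_
    rw [← latticeExp_add_left, ← AddSubgroup.coe_add, ← hf s, AddSubgroup.coe_add,
      latticeExp_add_left, hinv, one_mul]
  have h2 : (∑ s, latticeExp (t s) σ) * (latticeExp (k : E d) σ - 1) = 0 := by
    rw [mul_sub, mul_one, h1, sub_self]
  exact (mul_eq_zero.1 h2).resolve_right (sub_ne_zero.2 hk)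

/-- The matrix relating `ℳ(ω)` to `𝒰(a* ω)`; up to the unimodular factors `e^{-2π i t_s·ω}` it is
the character table of the finite group `Λ / a Λ`. -/
def charMatrix (t : Fin m → Γ.lattice) (ϱ : Fin m → Γ.dualLattice) (ω : E d) :
    Matrix (Fin m × Γ.pointGroup) (Fin m × Γ.pointGroup) ℂ :=
  Matrix.of fun p q => if p.2 = q.2 then ((1 / Real.sqrt m : ℝ) : ℂ) * latticeExp (t p.1)
    (ω + LinearMap.adjoint (a.lin.symm : E d →ₗ[ℝ] E d) (ϱ q.1)) else 0

theorem charMatrix_mem_unitary (ht : IsCosetReps Γ.lattice (a.lin : E d →ₗ[ℝ] E d) t)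
    {ϱ : Fin m → Γ.dualLattice}
    (hϱ : IsCosetReps Γ.dualLattice (LinearMap.adjoint (a.lin : E d →ₗ[ℝ] E d)) ϱ) (ω : E d) :
    charMatrix a t ϱ ω ∈ Matrix.unitaryGroup (Fin m × Γ.pointGroup) ℂ := by
  rw [Matrix.mem_unitaryGroup_iff']
  ext ⟨j, h⟩ ⟨j', h'⟩
  let σ : Fin m → E d := fun j => LinearMap.adjoint (a.lin.symm : E d →ₗ[ℝ] E d) (ϱ j)
  have hterm : ∀ s : Fin m, conj (((1 / Real.sqrt m : ℝ) : ℂ) * latticeExp (t s) (ω + σ j))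
      * (((1 / Real.sqrt m : ℝ) : ℂ) * latticeExp (t s) (ω + σ j'))
      = 1 / (m : ℂ) * latticeExp (t s) (σ j' - σ j) := by
    intro s
    rw [map_mul, Complex.conj_ofReal, conj_latticeExp, mul_mul_mul_comm, inv_sqrt_mul_inv_sqrt,
      ← latticeExp_add_right]
    congr 2
    abel
  have hsum : (star (charMatrix a t ϱ ω) * charMatrix a t ϱ ω) (j, h) (j', h')
      = if h = h' then 1 / (m : ℂ) * ∑ s, latticeExp (t s) (σ j' - σ j) else 0 := by
    rw [Matrix.mul_apply, Fintype.sum_prod_type, Finset.mul_sum]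
    by_cases hh : h = h'
    · subst hh
      rw [if_pos rfl]
      refine Finset.sum_congr rfl fun s _ => ?_
      rw [Finset.sum_eq_single h]
      · rw [← hterm]
        simp [charMatrix, Matrix.star_apply, σ]
      · intro g _ hg
        simp [charMatrix, Matrix.star_apply, hg]
      · simp
    · rw [if_neg hh]
      refine Finset.sum_eq_zero fun s _ => Finset.sum_eq_zero fun g _ => ?_
      by_cases hg : g = h
      · have : g ≠ h' := fun h1 => hh (hg ▸ h1)
        simp [charMatrix, this]
      · simp [charMatrix, Matrix.star_apply, hg]
  rw [hsum, Matrix.one_apply]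
  by_cases hh : h = h'
  · rw [if_pos hh]
    by_cases hj : j = j'
    · subst hj hh
      have hm : (m : ℂ) ≠ 0 := by
        have := j.pos
        exact_mod_cast this.ne'
      have h0 : ∀ k : E d, latticeExp k 0 = 1 := fun k => by simp [latticeExp]
      simp [h0, hm]
    · rw [if_neg (by simp [hj]), sum_latticeExp a ht _ (ϱ j' - ϱ j), mul_zero]
      · simp only [σ]
        rw [map_sub, a.dual_adjoint_symm, a.dual_adjoint_symm]
        rfl
      · intro hmem
        refine hj ((hϱ (ϱ j')).unique ⟨⟨_, hmem⟩, ?_⟩ ⟨0, ?_⟩)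
        · change (ϱ j' : E d) = a.dual (σ j' - σ j) + ϱ j
          simp only [σ]
          rw [map_sub, a.dual_adjoint_symm, a.dual_adjoint_symm, sub_add_cancel]
        · simp
  · rw [if_neg hh, if_neg]
    simp [hh]

/-- The identity `ℳ(ω) = 𝒰(a* ω) X(ω)`, with `X` the unitary matrix `charMatrix`. -/
theorem matM_ae_eq (ht : IsCosetReps Γ.lattice (a.lin : E d →ₗ[ℝ] E d) t)
    (ϱ : Fin m → Γ.dualLattice)
    {c : Fin m → Γ.lattice → Matrix Γ.pointGroup Γ.pointGroup ℂ} (hc : ∀ i, SquareSummable (c i)) :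
    ∀ᵐ ω ∂(volume : Measure (E d)), matM a ϱ c ω
      = torusMatU a t c (Γ.torusMap (a.dual ω)) * charMatrix a t ϱ ω := by
  have h1 : ∀ᵐ ω ∂(volume : Measure (E d)), ∀ (i : Fin m) (g g' : Γ.pointGroup),
      symbol m (c i) ω g g' = ∑ s, latticeExp (t s) ω * (((1 / Real.sqrt m : ℝ) : ℂ)
        * torusMatU a t c (Γ.torusMap (a.dual ω)) (i, g) (s, g')) := by
    simp only [ae_all_iff]
    intro i g g'
    have hA := fourierSum_polyphase a ht (summable_const_mul_sq (hc i g g') (1 / (m : ℂ)))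
    have hB : ∀ᵐ ω ∂(volume : Measure (E d)), ∀ s,
        fourierSum (fun l => 1 / (m : ℂ) * c i (a.onLattice l + t s) g g') ω
          = ((1 / Real.sqrt m : ℝ) : ℂ) * torusMatU a t c (Γ.torusMap ω) (i, g) (s, g') := by
      rw [ae_all_iff]
      intro s
      refine (isFourierSum_fourierSum (summable_coset a (hc i) (t s) g g' _)).ae_eq ?_
      convert (isFourierSum_quotientSum (summable_coset a (hc i) (t s) g g'
        ((1 / Real.sqrt m : ℝ) : ℂ))).const_mul ((1 / Real.sqrt m : ℝ) : ℂ) using 1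
      · funext l
        rw [← mul_assoc, inv_sqrt_mul_inv_sqrt]
      · rfl
    filter_upwards [hA, (a.ae_dual_iff _).2 hB] with ω hA hB
    change fourierSum (fun k => 1 / (m : ℂ) * c i k g g') ω = _
    rw [hA]
    exact Finset.sum_congr rfl fun s _ => by rw [hB]
  have h2 : ∀ᵐ ω ∂(volume : Measure (E d)), ∀ j : Fin m, ∀ (i : Fin m) (g g' : Γ.pointGroup),
      symbol m (c i) (ω + LinearMap.adjoint (a.lin.symm : E d →ₗ[ℝ] E d) (ϱ j)) g g'
        = ∑ s, latticeExp (t s) (ω + LinearMap.adjoint (a.lin.symm : E d →ₗ[ℝ] E d) (ϱ j))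
          * (((1 / Real.sqrt m : ℝ) : ℂ)
          * torusMatU a t c (Γ.torusMap (a.dual (ω +
            LinearMap.adjoint (a.lin.symm : E d →ₗ[ℝ] E d) (ϱ j)))) (i, g) (s, g')) := by
    rw [ae_all_iff]
    intro j
    exact (measurePreserving_add_right volume _).quasiMeasurePreserving.ae h1
  filter_upwards [h2] with ω hω
  ext ⟨i, g⟩ ⟨j, g'⟩
  change symbol m (c i) (ω + LinearMap.adjoint (a.lin.symm : E d →ₗ[ℝ] E d) (ϱ j)) g g' = _
  rw [hω, map_add, a.dual_adjoint_symm, Γ.torusMap_add_dual, Matrix.mul_apply,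
    Fintype.sum_prod_type]
  refine Finset.sum_congr rfl fun s _ => ?_
  rw [Finset.sum_eq_single g']
  · simp [charMatrix]
    ring
  · intro b _ hb
    simp [charMatrix, hb]
  · simp

theorem unitaryAE_matM_iff (ht : IsCosetReps Γ.lattice (a.lin : E d →ₗ[ℝ] E d) t)
    {ϱ : Fin m → Γ.dualLattice}
    (hϱ : IsCosetReps Γ.dualLattice (LinearMap.adjoint (a.lin : E d →ₗ[ℝ] E d)) ϱ)
    {c : Fin m → Γ.lattice → Matrix Γ.pointGroup Γ.pointGroup ℂ} (hc : ∀ i, SquareSummable (c i)) :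
    UnitaryAE (matM a ϱ c) ↔ UnitaryAE (matU a t c) := by
  rw [unitaryAE_matU_iff_torus a t hc, ← Γ.ae_torusMap_iff, ← a.ae_dual_iff]
  refine eventually_congr ?_
  filter_upwards [matM_ae_eq a ht ϱ hc] with ω hω
  have hX := charMatrix_mem_unitary a ht hϱ ω
  rw [hω]
  refine ⟨fun h => ?_, fun h => mul_mem h hX⟩
  have h1 := mul_mem h (Unitary.star_mem hX)
  rwa [Matrix.mul_assoc, Matrix.mem_unitaryGroup_iff.1 hX, Matrix.mul_one] at h1

end MatM

/-! ### Orthonormal families in a Hilbert space -/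

section Hilbert

open ComplexConjugate

variable {H : Type*} [NormedAddCommGroup H] [InnerProductSpace ℂ H]

theorem inner_eq_of_hasSum {ι : Type*} {B : ι → H} (hB : Orthonormal ℂ B) {c : ι → ℂ} {x : H}
    (hx : HasSum (fun i => c i • B i) x) (i : ι) : inner ℂ (B i) x = c i := by
  classical
  have h := (innerSL ℂ (B i)).hasSum hx
  refine HasSum.unique h ?_
  refine (hasSum_ite_eq i (c i)).congr_fun fun k => ?_
  change inner ℂ (B i) (c k • B k) = _
  rw [inner_smul_right, orthonormal_iff_ite.1 hB]
  by_cases hk : k = i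
  · simp [hk]
  · simp [hk, Ne.symm hk]

theorem hasSum_inner_of_hasSum {ι : Type*} {B : ι → H} (hB : Orthonormal ℂ B) {c c' : ι → ℂ}
    {x y : H} (hx : HasSum (fun i => c i • B i) x) (hy : HasSum (fun i => c' i • B i) y) :
    HasSum (fun i => c i * conj (c' i)) (inner ℂ y x) := by
  have h := (innerSL ℂ y).hasSum hx
  refine h.congr_fun fun i => ?_
  change _ = inner ℂ y (c i • B i)
  rw [inner_smul_right, ← inner_conj_symm, inner_eq_of_hasSum hB hy]

theorem hasSum_norm_sq_of_hasSum {ι : Type*} {B : ι → H} (hB : Orthonormal ℂ B) {c : ι → ℂ}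
    {x : H} (hx : HasSum (fun i => c i • B i) x) : HasSum (fun i => ‖c i‖ ^ 2) (‖x‖ ^ 2) := by
  have h := hasSum_inner_of_hasSum hB hx hx
  rw [← Complex.hasSum_ofReal]
  rw [inner_self_eq_norm_sq_to_K] at h
  convert h using 1
  · funext i
    rw [Complex.mul_conj, Complex.normSq_eq_norm_sq]
  · simp

/-- Equality in Bessel's inequality. -/
theorem mem_closure_span_of_hasSum_norm_sq {ι : Type*} {w : ι → H} (hw : Orthonormal ℂ w) {x : H}
    (hx : HasSum (fun i => ‖inner ℂ (w i) x‖ ^ 2) (‖x‖ ^ 2)) :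
    x ∈ (Submodule.span ℂ (Set.range w)).topologicalClosure := by
  have hn : ∀ s : Finset ι, ‖(∑ i ∈ s, inner ℂ (w i) x • w i) - x‖ ^ 2
      = ‖x‖ ^ 2 - ∑ i ∈ s, ‖inner ℂ (w i) x‖ ^ 2 := by
    intro s
    have h1 : inner ℂ (∑ i ∈ s, inner ℂ (w i) x • w i) (∑ i ∈ s, inner ℂ (w i) x • w i)
        = ((∑ i ∈ s, ‖inner ℂ (w i) x‖ ^ 2 : ℝ) : ℂ) := by
      rw [hw.inner_sum]
      push_cast
      refine Finset.sum_congr rfl fun i _ => ?_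
      rw [mul_comm, Complex.mul_conj, Complex.normSq_eq_norm_sq, Complex.ofReal_pow]
    have h2 : inner ℂ (∑ i ∈ s, inner ℂ (w i) x • w i) x
        = ((∑ i ∈ s, ‖inner ℂ (w i) x‖ ^ 2 : ℝ) : ℂ) := by
      rw [sum_inner]
      push_cast
      refine Finset.sum_congr rfl fun i _ => ?_
      rw [inner_smul_left, mul_comm, Complex.mul_conj, Complex.normSq_eq_norm_sq,
        Complex.ofReal_pow]
    have h3 : ‖∑ i ∈ s, inner ℂ (w i) x • w i‖ ^ 2 = ∑ i ∈ s, ‖inner ℂ (w i) x‖ ^ 2 := by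
      rw [inner_self_eq_norm_sq_to_K] at h1
      exact Complex.ofReal_injective (by rw [← h1]; simp)
    rw [@norm_sub_sq ℂ, h2, h3]
    simp only [RCLike.re_to_complex, Complex.ofReal_re]
    ring
  have hlim : Tendsto (fun s : Finset ι => ∑ i ∈ s, inner ℂ (w i) x • w i) atTop (𝓝 x) := by
    rw [tendsto_iff_norm_sub_tendsto_zero]
    have h1 : Tendsto (fun s : Finset ι => ‖(∑ i ∈ s, inner ℂ (w i) x • w i) - x‖ ^ 2) atTop
        (𝓝 0) := by
      simp only [hn]
      have : Tendsto (fun s : Finset ι => ‖x‖ ^ 2 - ∑ i ∈ s, ‖inner ℂ (w i) x‖ ^ 2) atTop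
          (𝓝 (‖x‖ ^ 2 - ‖x‖ ^ 2)) := tendsto_const_nhds.sub hx
      rwa [sub_self] at this
    have h2 := (Real.continuous_sqrt.tendsto 0).comp h1
    rw [Real.sqrt_zero] at h2
    refine h2.congr fun s => ?_
    simp only [Function.comp, Real.sqrt_sq (norm_nonneg _)]
  refine mem_closure_of_tendsto hlim (Eventually.of_forall fun s => ?_)
  exact Submodule.sum_mem _ fun i _ => Submodule.smul_mem _ _
    (Submodule.subset_span (Set.mem_range_self i))

/-- Two shift-invariant orthonormal families with the same finite number of generators: if the
second expands in the first, then the first lies in the closed span of the second. In the sum of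
Bessel's inequalities for the `B (r, l)` over the generators `r`, both sides equal the number of
generators, so that each of the inequalities is an equality. -/
theorem mem_closure_span_of_card_eq {R S Λ : Type*} [Fintype R] [Fintype S] [AddCommGroup Λ]
    (hcard : Fintype.card R = Fintype.card S) {B : R × Λ → H} {w : S × Λ → H}
    (hB : ∀ p, ‖B p‖ = 1) (hw : Orthonormal ℂ w) (n : R → S → Λ → ℂ)
    (hn : ∀ r l s v, inner ℂ (w (s, v)) (B (r, l)) = n r s (l - v))
    (hsum : ∀ s, HasSum (fun p : R × Λ => ‖n p.1 s p.2‖ ^ 2) 1) (p : R × Λ) :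
    B p ∈ (Submodule.span ℂ (Set.range w)).topologicalClosure := by
  have hs : ∀ r s, Summable fun l => ‖n r s l‖ ^ 2 := fun r s => (hsum s).summable.prod_factor r
  let F : R → S → ℝ := fun r s => ∑' l, ‖n r s l‖ ^ 2
  have hcol : ∀ s, ∑ r, F r s = 1 := fun s =>
    (hasSum_prod_of_fintype (f := fun p : R × Λ => ‖n p.1 s p.2‖ ^ 2)
      fun r => (hs r s).hasSum).unique (hsum s)
  have hrow : ∀ r l, HasSum (fun q : S × Λ => ‖inner ℂ (w q) (B (r, l))‖ ^ 2) (∑ s, F r s) := by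
    intro r l
    refine hasSum_prod_of_fintype fun s => ?_
    simp only [hn]
    exact (Equiv.subLeft l).hasSum_iff (f := fun l => ‖n r s l‖ ^ 2) |>.2 (hs r s).hasSum
  have hle : ∀ r ∈ Finset.univ, ∑ s, F r s ≤ 1 := by
    intro r _
    have h1 := hw.tsum_inner_products_le (x := B (r, 0))
    rwa [(hrow r 0).tsum_eq, hB, one_pow] at h1
  have htot : ∑ r, ∑ s, F r s = ∑ r : R, (1 : ℝ) := by
    rw [Finset.sum_comm, Finset.sum_congr rfl fun s _ => hcol s]
    simp [hcard]
  have heq := (Finset.sum_eq_sum_iff_of_le hle).1 htot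
  obtain ⟨r, l⟩ := p
  refine mem_closure_span_of_hasSum_norm_sq hw ?_
  rw [hB, one_pow, ← heq r (Finset.mem_univ r)]
  exact hrow r l

end Hilbert

/-! ### Composition with affine maps -/

section Comp

variable {d : ℕ}

theorem map_affine (e : E d ≃ᵃ[ℝ] E d) : Measure.map e (volume : Measure (E d))
    = ENNReal.ofReal |(LinearMap.det (e.linear : E d →ₗ[ℝ] E d))⁻¹| • volume := by
  have hl : LinearMap.det (e.linear : E d →ₗ[ℝ] E d) ≠ 0 :=
    (LinearEquiv.isUnit_det' e.linear).ne_zero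
  have hc : Measurable (e.linear : E d →ₗ[ℝ] E d) :=
    (LinearMap.continuous_of_finiteDimensional _).measurable
  have he : ⇑e = (fun y => y + e 0) ∘ (e.linear : E d →ₗ[ℝ] E d) := by
    funext x
    have := e.map_vadd 0 x
    simpa using this
  rw [he, ← Measure.map_map (measurable_add_const _) hc,
    Measure.map_linearMap_addHaar_eq_smul_addHaar volume hl, Measure.map_smul,
    map_add_right_eq_self]

theorem continuous_affine (e : E d ≃ᵃ[ℝ] E d) : Continuous e :=
  AffineMap.continuous_of_finiteDimensional (e : E d →ᵃ[ℝ] E d)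

theorem quasiMeasurePreserving_affine (e : E d ≃ᵃ[ℝ] E d) :
    Measure.QuasiMeasurePreserving e (volume : Measure (E d)) volume :=
  ⟨(continuous_affine e).measurable, by
    rw [map_affine]; exact Measure.smul_absolutelyContinuous⟩

theorem coeFn_comp (f : L2 d) (e : E d ≃ᵃ[ℝ] E d) : comp f e =ᵐ[volume] fun x => f (e x) :=
  (memLp_comp_affine e f).coeFn_toLp

theorem comp_comp (f : L2 d) (e e' : E d ≃ᵃ[ℝ] E d) :
    comp (comp f e) e' = comp f (e'.trans e) := by
  refine Lp.ext ?_
  filter_upwards [coeFn_comp (comp f e) e', coeFn_comp f (e'.trans e),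
    (quasiMeasurePreserving_affine e').ae (coeFn_comp f e)] with x h1 h2 h3
  rw [h1, h2, h3]
  rfl

theorem comp_refl (f : L2 d) : comp f (AffineEquiv.refl ℝ (E d)) = f := by
  refine Lp.ext ?_
  filter_upwards [coeFn_comp f (AffineEquiv.refl ℝ (E d))] with x h1
  rw [h1]
  rfl

theorem comp_add (f f' : L2 d) (e : E d ≃ᵃ[ℝ] E d) : comp (f + f') e = comp f e + comp f' e := by
  refine Lp.ext ?_
  filter_upwards [coeFn_comp (f + f') e, coeFn_comp f e, coeFn_comp f' e,
    Lp.coeFn_add (comp f e) (comp f' e),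
    (quasiMeasurePreserving_affine e).ae (Lp.coeFn_add f f')] with x h1 h2 h3 h4 h5
  rw [h1, h4, h5, Pi.add_apply, Pi.add_apply, h2, h3]

theorem comp_smul (z : ℂ) (f : L2 d) (e : E d ≃ᵃ[ℝ] E d) : comp (z • f) e = z • comp f e := by
  refine Lp.ext ?_
  filter_upwards [coeFn_comp (z • f) e, coeFn_comp f e, Lp.coeFn_smul z (comp f e),
    (quasiMeasurePreserving_affine e).ae (Lp.coeFn_smul z f)] with x h1 h2 h3 h4
  rw [h1, h3, h4, Pi.smul_apply, Pi.smul_apply, h2]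

/-- Composition with an affine map is a multiple of an isometry. -/
theorem inner_comp (f f' : L2 d) (e : E d ≃ᵃ[ℝ] E d) : inner ℂ (comp f e) (comp f' e)
    = ((|LinearMap.det (e.linear : E d →ₗ[ℝ] E d)|⁻¹ : ℝ) : ℂ) * inner ℂ f f' := by
  rw [L2.inner_def, L2.inner_def]
  have h1 : ∫ x, inner ℂ (comp f e x) (comp f' e x) = ∫ x, inner ℂ (f (e x)) (f' (e x)) := by
    refine integral_congr_ae ?_
    filter_upwards [coeFn_comp f e, coeFn_comp f' e] with x h1 h2
    rw [h1, h2]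
  have hemb : MeasurableEmbedding e :=
    (Homeomorph.mk e.toEquiv (continuous_affine e)
      (continuous_affine e.symm)).measurableEmbedding
  rw [h1, ← hemb.integral_map (fun y => inner ℂ (f y) (f' y)), map_affine, integral_smul_measure,
    ENNReal.toReal_ofReal (abs_nonneg _), abs_inv, Complex.real_smul]

/-- Composition with an affine map, as a continuous linear operator. -/
def compCLM (e : E d ≃ᵃ[ℝ] E d) : L2 d →L[ℂ] L2 d :=
  LinearMap.mkContinuous
    { toFun := fun f => comp f e
      map_add' := fun f f' => comp_add f f' e
      map_smul' := fun z f => comp_smul z f e }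
    (Real.sqrt |LinearMap.det (e.linear : E d →ₗ[ℝ] E d)|⁻¹) fun f => by
      have h := inner_comp f f e
      rw [inner_self_eq_norm_sq_to_K, inner_self_eq_norm_sq_to_K] at h
      have h1 : ‖comp f e‖ ^ 2 = |LinearMap.det (e.linear : E d →ₗ[ℝ] E d)|⁻¹ * ‖f‖ ^ 2 := by
        refine Complex.ofReal_injective ?_
        rw [Complex.ofReal_mul, Complex.ofReal_pow, Complex.ofReal_pow]
        exact h
      rw [← Real.sqrt_sq (norm_nonneg f), ← Real.sqrt_mul (by positivity), ← h1,
        Real.sqrt_sq (norm_nonneg _)]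
      rfl

theorem compCLM_apply (e : E d ≃ᵃ[ℝ] E d) (f : L2 d) : compCLM e f = comp f e := rfl

theorem abs_det_isometry (γ : E d ≃ᵃⁱ[ℝ] E d) :
    |LinearMap.det (γ.toAffineEquiv.linear : E d →ₗ[ℝ] E d)| = 1 := by
  have h1 := map_affine γ.linearIsometryEquiv.toLinearEquiv.toAffineEquiv
  have h2 : Measure.map γ.linearIsometryEquiv.toLinearEquiv.toAffineEquiv
      (volume : Measure (E d)) = volume := γ.linearIsometryEquiv.measurePreserving.map_eq
  rw [h2] at h1
  have h3 := congrArg (fun μ : Measure (E d) => μ (Metric.ball 0 1)) h1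
  simp only [Measure.smul_apply, smul_eq_mul] at h3
  have hpos : volume (Metric.ball (0 : E d) 1) ≠ 0 :=
    (Metric.measure_ball_pos volume (0 : E d) one_pos).ne'
  have hfin : volume (Metric.ball (0 : E d) 1) ≠ ∞ := measure_ball_lt_top.ne
  have h4 : ENNReal.ofReal |(LinearMap.det (γ.toAffineEquiv.linear : E d →ₗ[ℝ] E d))⁻¹| = 1 :=
    (ENNReal.mul_eq_right hpos hfin).1 h3.symm
  rwa [ENNReal.ofReal_eq_one, abs_inv, inv_eq_one] at h4

theorem D_isometry (γ : E d ≃ᵃⁱ[ℝ] E d) (f : L2 d) :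
    D γ.toAffineEquiv f = comp f γ.symm.toAffineEquiv := by
  rw [D, abs_det_isometry]
  simp only [Real.sqrt_one, inv_one, Complex.ofReal_one, one_smul]
  rfl

theorem inner_D_isometry (γ : E d ≃ᵃⁱ[ℝ] E d) (f f' : L2 d) :
    inner ℂ (D γ.toAffineEquiv f) (D γ.toAffineEquiv f') = inner ℂ f f' := by
  rw [D_isometry, D_isometry, inner_comp, abs_det_isometry]
  simp

end Comp

/-! ### The action of the crystal group on `L²` -/

section Action

open ComplexConjugate

variable {d : ℕ} {Γ : SplittingCrystalGroup d}

theorem SplittingCrystalGroup.elt_apply (g : Γ.pointGroup) (k : Γ.lattice) (x : E d) :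
    (Γ.elt g k : E d ≃ᵃⁱ[ℝ] E d) x = (g : E d ≃ₗᵢ[ℝ] E d) (x + k) := by
  simp [SplittingCrystalGroup.elt, add_comm]

/-- The element `x ↦ g x + k` of `Γ`. -/
def SplittingCrystalGroup.aff (p : Γ.lattice × Γ.pointGroup) : Γ.grp :=
  Γ.elt p.2 (Γ.act p.2⁻¹ p.1)

theorem SplittingCrystalGroup.aff_apply (p : Γ.lattice × Γ.pointGroup) (x : E d) :
    (Γ.aff p : E d ≃ᵃⁱ[ℝ] E d) x = (p.2 : E d ≃ₗᵢ[ℝ] E d) x + p.1 := by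
  rw [SplittingCrystalGroup.aff, elt_apply, map_add]
  congr 1
  exact (p.2 : E d ≃ₗᵢ[ℝ] E d).apply_symm_apply p.1

theorem SplittingCrystalGroup.aff_symm_apply (p : Γ.lattice × Γ.pointGroup) (x : E d) :
    (Γ.aff p : E d ≃ᵃⁱ[ℝ] E d).symm x = (p.2 : E d ≃ₗᵢ[ℝ] E d).symm (x - p.1) := by
  rw [AffineIsometryEquiv.symm_apply_eq, aff_apply]
  simp

theorem SplittingCrystalGroup.aff_bijective : Function.Bijective (Γ.aff) := by
  constructor
  · rintro ⟨k, g⟩ ⟨l, h⟩ e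
    have e1 : ∀ x, (g : E d ≃ₗᵢ[ℝ] E d) x + k = (h : E d ≃ₗᵢ[ℝ] E d) x + l := by
      intro x
      rw [← Γ.aff_apply (k, g), e, Γ.aff_apply]
    have e2 : (k : E d) = l := by simpa using e1 0
    have e3 : g = h := by
      ext1
      refine LinearIsometryEquiv.ext fun x => ?_
      have := e1 x
      rw [e2] at this
      exact add_right_cancel this
    rw [Subtype.ext e2, e3]
  · intro γ
    refine ⟨(⟨(γ : E d ≃ᵃⁱ[ℝ] E d) 0, Γ.apply_zero_mem_lattice γ γ.2⟩,
      ⟨(γ : E d ≃ᵃⁱ[ℝ] E d).linearIsometryEquiv, γ, γ.2, rfl⟩), ?_⟩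
    refine Subtype.ext (AffineIsometryEquiv.ext fun x => ?_)
    rw [aff_apply]
    have := (γ : E d ≃ᵃⁱ[ℝ] E d).map_vadd 0 x
    simp only [vadd_eq_add, add_zero] at this
    exact this.symm

/-- The parametrization of `Γ` by pairs `(k, g)`, through the maps `x ↦ g x + k`. -/
def SplittingCrystalGroup.affEquiv (Γ : SplittingCrystalGroup d) :
    Γ.lattice × Γ.pointGroup ≃ Γ.grp :=
  Equiv.ofBijective Γ.aff Γ.aff_bijective

theorem comp_congr (f : L2 d) {e e' : E d ≃ᵃ[ℝ] E d} (h : ∀ x, e x = e' x) :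
    comp f e = comp f e' := by
  rw [AffineEquiv.ext h]

theorem D_mul (γ γ' : E d ≃ᵃⁱ[ℝ] E d) (f : L2 d) :
    D (γ * γ').toAffineEquiv f = D γ.toAffineEquiv (D γ'.toAffineEquiv f) := by
  rw [D_isometry, D_isometry, D_isometry, comp_comp]
  exact comp_congr f fun x => rfl

theorem orbitVec_eq (f : L2 d) (g : Γ.pointGroup) :
    orbitVec f g = D (Γ.aff (0, g) : E d ≃ᵃⁱ[ℝ] E d).toAffineEquiv f := by
  have h : (Γ.aff (0, g) : E d ≃ᵃⁱ[ℝ] E d) = (g : E d ≃ₗᵢ[ℝ] E d).toAffineIsometryEquiv := by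
    ext1 x
    rw [Γ.aff_apply]
    simp
  rw [h]
  rfl

theorem D_one (f : L2 d) : D (1 : E d ≃ᵃⁱ[ℝ] E d).toAffineEquiv f = f := by
  rw [D_isometry]
  exact comp_refl f

theorem orbitVec_one (f : L2 d) : orbitVec f (1 : Γ.pointGroup) = f := by
  rw [orbitVec_eq]
  have : (Γ.aff (0, 1) : E d ≃ᵃⁱ[ℝ] E d) = 1 := by
    ext1 x
    rw [Γ.aff_apply]
    simp
  rw [this, D_one]

variable (a : AdmissibleMatrix Γ)

/-- The function `φ (g⁻¹ (a x - k))`. -/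
def dilated (φ : L2 d) (p : Γ.lattice × Γ.pointGroup) : L2 d :=
  comp (orbitVec φ p.2)
    (a.lin.toAffineEquiv.trans (AffineEquiv.constVAdd ℝ (E d) (-(p.1 : E d))))

theorem dilated_eq (φ : L2 d) (p : Γ.lattice × Γ.pointGroup) :
    dilated a φ p = comp φ
      (a.lin.toAffineEquiv.trans (Γ.aff p : E d ≃ᵃⁱ[ℝ] E d).symm.toAffineEquiv) := by
  rw [dilated, orbitVec_eq, D_isometry, comp_comp]
  refine comp_congr φ fun x => ?_
  change (Γ.aff (0, p.2) : E d ≃ᵃⁱ[ℝ] E d).symm (-(p.1 : E d) + a.lin x)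
    = (Γ.aff p : E d ≃ᵃⁱ[ℝ] E d).symm (a.lin x)
  rw [Γ.aff_symm_apply, Γ.aff_symm_apply, neg_add_eq_sub]
  simp

theorem dilated_eq_comp_D (φ : L2 d) (p : Γ.lattice × Γ.pointGroup) :
    dilated a φ p = comp (D (Γ.aff p : E d ≃ᵃⁱ[ℝ] E d).toAffineEquiv φ) a.lin.toAffineEquiv := by
  rw [dilated_eq, D_isometry, comp_comp]

theorem AdmissibleMatrix.conj_symm_apply (g : Γ.pointGroup) (x : E d) :
    (a.conj g : E d ≃ₗᵢ[ℝ] E d).symm (a.lin x) = a.lin ((g : E d ≃ₗᵢ[ℝ] E d).symm x) := by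
  rw [LinearIsometryEquiv.symm_apply_eq, a.conj_apply]
  simp

/-- If `f = ∑ c_γ φ(γ⁻¹(a ·))`, then the coefficients of the translate by `v` of `f ∘ g⁻¹` in the
functions `φ(h⁻¹(a x - k))` form the `g`-th row of the coefficient matrix at `k - a v`. -/
theorem HasScalarExpansion.hasSum_D {φ f : L2 d} {c : Γ.grp → ℂ}
    (hc : HasScalarExpansion a φ c f) (v : Γ.lattice) (g : Γ.pointGroup) :
    HasSum (fun p : Γ.lattice × Γ.pointGroup =>
      coeffMatrix a c (p.1 - a.onLattice v) g p.2 • dilated a φ p)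
      (D (Γ.aff (v, g) : E d ≃ᵃⁱ[ℝ] E d).toAffineEquiv f) := by
  have h1 := (compCLM (Γ.aff (v, g) : E d ≃ᵃⁱ[ℝ] E d).symm.toAffineEquiv).hasSum hc
  have h2 := (Γ.affEquiv.trans
    (Equiv.mulLeft (Γ.aff (a.onLattice v, a.conj g))⁻¹)).hasSum_iff.2 h1
  rw [D_isometry]
  refine h2.congr_fun fun p => ?_
  have he : Γ.elt ((a.conj g)⁻¹ * p.2) (Γ.act p.2⁻¹ (p.1 - a.onLattice v))
      = (Γ.aff (a.onLattice v, a.conj g))⁻¹ * Γ.aff p := by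
    rw [eq_inv_mul_iff_mul_eq]
    refine Subtype.ext (AffineIsometryEquiv.ext fun x => ?_)
    change (Γ.aff (a.onLattice v, a.conj g) : E d ≃ᵃⁱ[ℝ] E d) ((Γ.elt ((a.conj g)⁻¹ * p.2)
      (Γ.act p.2⁻¹ (p.1 - a.onLattice v)) : E d ≃ᵃⁱ[ℝ] E d) x) = _
    rw [Γ.aff_apply, Γ.aff_apply, Γ.elt_apply]
    change (a.conj g : E d ≃ₗᵢ[ℝ] E d) ((a.conj g : E d ≃ₗᵢ[ℝ] E d).symm
      ((p.2 : E d ≃ₗᵢ[ℝ] E d) (x + (p.2 : E d ≃ₗᵢ[ℝ] E d).symm ((p.1 : E d) - a.onLattice v))))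
      + a.onLattice v = _
    rw [LinearIsometryEquiv.apply_symm_apply, map_add, LinearIsometryEquiv.apply_symm_apply]
    abel
  change coeffMatrix a c (p.1 - a.onLattice v) g p.2 • dilated a φ p
    = compCLM _ (c ((Γ.aff (a.onLattice v, a.conj g))⁻¹ * Γ.aff p) • comp φ
      (a.lin.toAffineEquiv.trans (((Γ.aff (a.onLattice v, a.conj g))⁻¹ * Γ.aff p :
        Γ.grp) : E d ≃ᵃⁱ[ℝ] E d).symm.toAffineEquiv))
  rw [map_smul, compCLM_apply, comp_comp, ← he]
  refine congrArg₂ (fun (z : ℂ) (y : L2 d) => z • y) rfl ?_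
  rw [dilated_eq]
  refine comp_congr φ fun x => ?_
  rw [he]
  change (Γ.aff p : E d ≃ᵃⁱ[ℝ] E d).symm (a.lin x) = (Γ.aff p : E d ≃ᵃⁱ[ℝ] E d).symm
    ((Γ.aff (a.onLattice v, a.conj g) : E d ≃ᵃⁱ[ℝ] E d)
      (a.lin ((Γ.aff (v, g) : E d ≃ᵃⁱ[ℝ] E d).symm x)))
  congr 1
  rw [Γ.aff_apply, Γ.aff_symm_apply, ← a.conj_symm_apply, LinearIsometryEquiv.apply_symm_apply,
    map_sub]
  exact (sub_add_cancel _ _).symm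

end Action

/-! ### Orthonormal bases of `V₁` and of `W₀` -/

section MRA

open ComplexConjugate

variable {d : ℕ} {Γ : SplittingCrystalGroup d} {a : AdmissibleMatrix Γ} {φ : L2 d}
  {V : ℤ → Submodule ℂ (L2 d)}

/-- The functions `√m φ(g⁻¹(a x - k))`, where `m = |det a|`. -/
def unitDilated (a : AdmissibleMatrix Γ) (φ : L2 d) (p : Γ.lattice × Γ.pointGroup) : L2 d :=
  ((Real.sqrt |LinearMap.det (a.lin : E d →ₗ[ℝ] E d)| : ℝ) : ℂ) • dilated a φ p

theorem abs_det_pos (a : AdmissibleMatrix Γ) : 0 < |LinearMap.det (a.lin : E d →ₗ[ℝ] E d)| :=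
  abs_pos.2 (LinearEquiv.isUnit_det' a.lin).ne_zero

theorem sqrt_det_ne_zero (a : AdmissibleMatrix Γ) :
    ((Real.sqrt |LinearMap.det (a.lin : E d →ₗ[ℝ] E d)| : ℝ) : ℂ) ≠ 0 :=
  Complex.ofReal_ne_zero.2 (Real.sqrt_pos.2 (abs_det_pos a)).ne'

theorem smul_dilated (z : ℂ) (p : Γ.lattice × Γ.pointGroup) :
    z • dilated a φ p = (z / ((Real.sqrt |LinearMap.det (a.lin : E d →ₗ[ℝ] E d)| : ℝ) : ℂ))
      • unitDilated a φ p := by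
  rw [unitDilated, smul_smul, div_mul_cancel₀ _ (sqrt_det_ne_zero a)]

theorem IsMRA.inner_D (hV : IsMRA a (fun _ : Fin 1 => φ) V) (γ γ' : Γ.grp) :
    inner ℂ (D (γ : E d ≃ᵃⁱ[ℝ] E d).toAffineEquiv φ) (D (γ' : E d ≃ᵃⁱ[ℝ] E d).toAffineEquiv φ)
      = open Classical in if γ = γ' then (1 : ℂ) else 0 := by
  classical
  have := orthonormal_iff_ite.1 hV.basis.1 (γ, 0) (γ', 0)
  simpa using this

theorem IsMRA.orthonormal_unitDilated (hV : IsMRA a (fun _ : Fin 1 => φ) V) :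
    Orthonormal ℂ (unitDilated a φ) := by
  classical
  rw [orthonormal_iff_ite]
  intro p q
  have h : (Γ.aff p = Γ.aff q) ↔ p = q := Γ.aff_bijective.1.eq_iff
  rw [unitDilated, unitDilated, inner_smul_left, inner_smul_right, dilated_eq_comp_D,
    dilated_eq_comp_D, inner_comp, hV.inner_D, ← mul_assoc, ← mul_assoc, Complex.conj_ofReal,
    ← Complex.ofReal_mul, Real.mul_self_sqrt (abs_nonneg _), ← Complex.ofReal_mul]
  have h1 : |LinearMap.det (a.lin : E d →ₗ[ℝ] E d)| *
    |LinearMap.det (a.lin.toAffineEquiv.linear : E d →ₗ[ℝ] E d)|⁻¹ = 1 :=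
      mul_inv_cancel₀ (abs_det_pos a).ne'
  rw [h1, Complex.ofReal_one, one_mul]
  simp only [h]

theorem D_symm_eq (f : L2 d) : D a.lin.symm.toAffineEquiv f
    = ((Real.sqrt |LinearMap.det (a.lin : E d →ₗ[ℝ] E d)| : ℝ) : ℂ) •
      comp f a.lin.toAffineEquiv := by
  have h : LinearMap.det (a.lin.symm : E d →ₗ[ℝ] E d)
      = (LinearMap.det (a.lin : E d →ₗ[ℝ] E d))⁻¹ := LinearEquiv.det_coe_symm a.lin
  change (((Real.sqrt |LinearMap.det (a.lin.symm : E d →ₗ[ℝ] E d)|)⁻¹ : ℝ) : ℂ) • _ = _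
  rw [h, abs_inv, Real.sqrt_inv, inv_inv]
  rfl

theorem D_symm_D (p : Γ.lattice × Γ.pointGroup) : D a.lin.symm.toAffineEquiv
    (D (Γ.aff p : E d ≃ᵃⁱ[ℝ] E d).toAffineEquiv φ) = unitDilated a φ p := by
  rw [D_symm_eq, unitDilated, dilated_eq_comp_D]

theorem IsMRA.D_mem (hV : IsMRA a (fun _ : Fin 1 => φ) V) (γ : Γ.grp) :
    D (γ : E d ≃ᵃⁱ[ℝ] E d).toAffineEquiv φ ∈ V 0 := by
  rw [← hV.basis.2]
  exact Submodule.le_topologicalClosure _ (Submodule.subset_span ⟨(γ, 0), rfl⟩)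

/-- `V₁ = D_a⁻¹ V₀` is spanned by the images of the basis of `V₀`. -/
theorem IsMRA.V_one_eq (hV : IsMRA a (fun _ : Fin 1 => φ) V) :
    (Submodule.span ℂ (Set.range (unitDilated a φ))).topologicalClosure = V 1 := by
  have hV1 : (V 1 : Set (L2 d)) = D a.lin.symm.toAffineEquiv '' (V 0 : Set (L2 d)) := by
    simpa using hV.dilate 0
  refine le_antisymm ?_ ?_
  · refine Submodule.topologicalClosure_minimal _ ?_ (hV.closed 1)
    rw [Submodule.span_le]
    rintro _ ⟨p, rfl⟩
    rw [hV1, ← D_symm_D]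
    exact ⟨_, hV.D_mem _, rfl⟩
  · intro x hx
    have hx' : x ∈ (V 1 : Set (L2 d)) := hx
    rw [hV1] at hx'
    obtain ⟨y, hy, rfl⟩ := hx'
    let T : L2 d →L[ℂ] L2 d :=
      ((Real.sqrt |LinearMap.det (a.lin : E d →ₗ[ℝ] E d)| : ℝ) : ℂ) • compCLM a.lin.toAffineEquiv
    have hT : ∀ f, T f = D a.lin.symm.toAffineEquiv f := fun f => (D_symm_eq f).symm
    have hle : V 0 ≤ ((Submodule.span ℂ (Set.range (unitDilated a φ))).topologicalClosure).comap
        (T : L2 d →ₗ[ℂ] L2 d) := by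
      rw [← hV.basis.2]
      refine Submodule.topologicalClosure_minimal _ ?_
        ((Submodule.isClosed_topologicalClosure _).preimage T.continuous)
      rw [Submodule.span_le]
      rintro _ ⟨⟨γ, i⟩, rfl⟩
      obtain ⟨p, rfl⟩ := Γ.aff_bijective.2 γ
      refine Submodule.le_topologicalClosure _ (Submodule.subset_span ⟨p, ?_⟩)
      rw [← D_symm_D]
      exact (hT _).symm
    rw [← hT]
    exact hle hy

variable {f : L2 d} {c : Γ.grp → ℂ}

theorem HasScalarExpansion.hasSum_unitDilated (hc : HasScalarExpansion a φ c f) (v : Γ.lattice)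
    (g : Γ.pointGroup) : HasSum (fun p : Γ.lattice × Γ.pointGroup =>
      (coeffMatrix a c (p.1 - a.onLattice v) g p.2
        / ((Real.sqrt |LinearMap.det (a.lin : E d →ₗ[ℝ] E d)| : ℝ) : ℂ)) • unitDilated a φ p)
      (D (Γ.aff (v, g) : E d ≃ᵃⁱ[ℝ] E d).toAffineEquiv f) :=
  (hc.hasSum_D a v g).congr_fun fun _ => (smul_dilated _ _).symm

theorem HasScalarExpansion.hasSum_orbitVec (hc : HasScalarExpansion a φ c f)
    (g : Γ.pointGroup) : HasSum (fun p : Γ.lattice × Γ.pointGroup =>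
      coeffMatrix a c p.1 g p.2 • dilated a φ p) (orbitVec f g) := by
  have := hc.hasSum_D a 0 g
  rw [a.onLattice_zero, ← orbitVec_eq] at this
  simpa only [sub_zero] using this

theorem HasScalarExpansion.D_mem (hV : IsMRA a (fun _ : Fin 1 => φ) V)
    (hc : HasScalarExpansion a φ c f) (γ : Γ.grp) :
    D (γ : E d ≃ᵃⁱ[ℝ] E d).toAffineEquiv f ∈ V 1 := by
  obtain ⟨⟨v, g⟩, rfl⟩ := Γ.aff_bijective.2 γ
  rw [← hV.V_one_eq]
  refine mem_closure_of_tendsto (hc.hasSum_unitDilated v g) (Eventually.of_forall fun s => ?_)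
  exact Submodule.sum_mem _ fun i _ => Submodule.smul_mem _ _
    (Submodule.subset_span (Set.mem_range_self i))

theorem squareSummable_of_summable {C : Γ.lattice → Matrix Γ.pointGroup Γ.pointGroup ℂ}
    (h : ∀ g, Summable fun p : Γ.lattice × Γ.pointGroup => ‖C p.1 g p.2‖ ^ 2) :
    SquareSummable C := fun g g' =>
  (h g).comp_injective (i := fun k => (k, g')) (Prod.mk_left_injective g')

theorem HasScalarExpansion.squareSummable (hV : IsMRA a (fun _ : Fin 1 => φ) V)
    (hc : HasScalarExpansion a φ c f) : SquareSummable (coeffMatrix a c) := by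
  refine squareSummable_of_summable fun g => ?_
  have h := (hasSum_norm_sq_of_hasSum hV.orthonormal_unitDilated
    (hc.hasSum_unitDilated 0 g)).summable
  rw [a.onLattice_zero] at h
  simp only [sub_zero, norm_div, div_pow] at h
  refine (h.mul_right (‖((Real.sqrt |LinearMap.det (a.lin : E d →ₗ[ℝ] E d)| : ℝ) : ℂ)‖ ^ 2)).congr
    fun p => ?_
  rw [div_mul_cancel₀]
  exact pow_ne_zero 2 (norm_ne_zero_iff.2 (sqrt_det_ne_zero a))

variable {m : ℕ} {F : Fin m → L2 d} {cF : Fin m → Γ.grp → ℂ}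

/-- The sums in the discrete orthogonality relations are inner products of translates. -/
theorem hasSum_inner_D (hV : IsMRA a (fun _ : Fin 1 => φ) V)
    (hm : (m : ℝ) = |LinearMap.det (a.lin : E d →ₗ[ℝ] E d)|)
    (hF : ∀ i, HasScalarExpansion a φ (cF i) (F i)) (v : Γ.lattice) (p q : Fin m × Γ.pointGroup) :
    HasSum (fun k => ((1 / (m : ℂ)) • (coeffMatrix a (cF p.1) k *
        (coeffMatrix a (cF q.1) (k - a.onLattice v)).conjTranspose)) p.2 q.2)
      (inner ℂ (D (Γ.aff (v, q.2) : E d ≃ᵃⁱ[ℝ] E d).toAffineEquiv (F q.1))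
        (D (Γ.aff (0, p.2) : E d ≃ᵃⁱ[ℝ] E d).toAffineEquiv (F p.1))) := by
  have h := hasSum_inner_of_hasSum hV.orthonormal_unitDilated
    ((hF p.1).hasSum_unitDilated 0 p.2) ((hF q.1).hasSum_unitDilated v q.2)
  refine (h.prod_fiberwise fun k => hasSum_fintype _).congr_fun fun k => ?_
  have hs : (1 / (m : ℂ)) = 1 / ((Real.sqrt |LinearMap.det (a.lin : E d →ₗ[ℝ] E d)| : ℝ) : ℂ) *
      (1 / ((Real.sqrt |LinearMap.det (a.lin : E d →ₗ[ℝ] E d)| : ℝ) : ℂ)) := by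
    rw [← hm, ← inv_sqrt_mul_inv_sqrt]
    push_cast
    rfl
  rw [Matrix.smul_apply, Matrix.mul_apply, smul_eq_mul, Finset.mul_sum]
  refine Finset.sum_congr rfl fun g _ => ?_
  rw [a.onLattice_zero, sub_zero, map_div₀, Complex.conj_ofReal, hs, Matrix.conjTranspose_apply]
  simp only [RCLike.star_def]
  ring

theorem inner_D_mul (γ₀ γ γ' : Γ.grp) (f f' : L2 d) :
    inner ℂ (D ((γ₀ * γ : Γ.grp) : E d ≃ᵃⁱ[ℝ] E d).toAffineEquiv f)
      (D ((γ₀ * γ' : Γ.grp) : E d ≃ᵃⁱ[ℝ] E d).toAffineEquiv f')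
    = inner ℂ (D (γ : E d ≃ᵃⁱ[ℝ] E d).toAffineEquiv f)
      (D (γ' : E d ≃ᵃⁱ[ℝ] E d).toAffineEquiv f') := by
  rw [Subgroup.coe_mul, Subgroup.coe_mul, D_mul, D_mul, inner_D_isometry]

theorem SplittingCrystalGroup.aff_translate (v w : Γ.lattice) (g : Γ.pointGroup) :
    Γ.aff (v + w, g) = Γ.aff (v, 1) * Γ.aff (w, g) := by
  refine Subtype.ext (AffineIsometryEquiv.ext fun x => ?_)
  change _ = (Γ.aff (v, 1) : E d ≃ᵃⁱ[ℝ] E d) ((Γ.aff (w, g) : E d ≃ᵃⁱ[ℝ] E d) x)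
  rw [Γ.aff_apply, Γ.aff_apply, Γ.aff_apply]
  simp only [AddSubgroup.coe_add]
  change _ = ((g : E d ≃ₗᵢ[ℝ] E d) x + w) + v
  abel

/-- By invariance under translations it suffices to test orthonormality against the functions
`D_g ψ^i` with `g` in the point group, which gives the discrete orthogonality relations. -/
theorem orthonormal_D_iff (hV : IsMRA a (fun _ : Fin 1 => φ) V)
    (hm : (m : ℝ) = |LinearMap.det (a.lin : E d →ₗ[ℝ] E d)|)
    (hF : ∀ i, HasScalarExpansion a φ (cF i) (F i)) :
    Orthonormal ℂ (fun p : Γ.grp × Fin m => D (p.1 : E d ≃ᵃⁱ[ℝ] E d).toAffineEquiv (F p.2)) ↔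
      DiscreteOrthogonality a fun i => coeffMatrix a (cF i) := by
  classical
  rw [discreteOrthogonality_iff, orthonormal_iff_ite]
  have hiff : ∀ (v : Γ.lattice) (p q : Fin m × Γ.pointGroup),
      ((Γ.aff (v, q.2), q.1) = (Γ.aff (0, p.2), p.1)) ↔ (v = 0 ∧ p = q) := by
    rintro v ⟨i, g⟩ ⟨j, h⟩
    simp only [Prod.mk.injEq, Γ.aff_bijective.1.eq_iff]
    constructor
    · rintro ⟨⟨h1, h2⟩, h3⟩
      exact ⟨h1, h3.symm, h2.symm⟩
    · rintro ⟨h1, h2, h3⟩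
      exact ⟨⟨h1, h3.symm⟩, h2.symm⟩
  constructor
  · intro h v p q
    convert hasSum_inner_D hV hm hF v p q using 1
    have := h (Γ.aff (v, q.2), q.1) (Γ.aff (0, p.2), p.1)
    rw [this]
    simp only [hiff]
  · rintro h ⟨γ, j⟩ ⟨γ', i⟩
    obtain ⟨⟨v, g'⟩, rfl⟩ := Γ.aff_bijective.2 γ
    obtain ⟨⟨w, g⟩, rfl⟩ := Γ.aff_bijective.2 γ'
    have h1 := (hasSum_inner_D hV hm hF (v - w) (i, g) (j, g')).unique (h (v - w) (i, g) (j, g'))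
    have e1 : Γ.aff (v, g') = Γ.aff (w, 1) * Γ.aff (v - w, g') := by
      rw [← Γ.aff_translate, add_sub_cancel]
    have e2 : Γ.aff (w, g) = Γ.aff (w, 1) * Γ.aff (0, g) := by
      rw [← Γ.aff_translate, add_zero]
    simp only
    rw [e1, e2, inner_D_mul, h1]
    simp only [Prod.mk.injEq, mul_right_inj, Γ.aff_bijective.1.eq_iff]
    congr 1
    simp only [eq_iff_iff]
    constructor
    · rintro ⟨h1, h2, h3⟩
      exact ⟨⟨h1, h3.symm⟩, h2.symm⟩
    · rintro ⟨⟨h1, h3⟩, h2⟩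
      exact ⟨h1, h2.symm, h3.symm⟩

/-- An orthonormal system of translates with `m = |Λ / a Λ|` generators in `V₁` is complete. -/
theorem V_one_le_of_orthonormal (hV : IsMRA a (fun _ : Fin 1 => φ) V)
    {t : Fin m → Γ.lattice} (ht : IsCosetReps Γ.lattice (a.lin : E d →ₗ[ℝ] E d) t)
    (hF : ∀ i, HasScalarExpansion a φ (cF i) (F i))
    (hO : Orthonormal ℂ
      (fun p : Γ.grp × Fin m => D (p.1 : E d ≃ᵃⁱ[ℝ] E d).toAffineEquiv (F p.2))) :
    V 1 ≤ (Submodule.span ℂ (Set.range fun p : Γ.grp × Fin m =>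
      D (p.1 : E d ≃ᵃⁱ[ℝ] E d).toAffineEquiv (F p.2))).topologicalClosure := by
  let s : ℂ := ((Real.sqrt |LinearMap.det (a.lin : E d →ₗ[ℝ] E d)| : ℝ) : ℂ)
  let w : (Fin m × Γ.pointGroup) × Γ.lattice → L2 d :=
    (fun p : Γ.grp × Fin m => D (p.1 : E d ≃ᵃⁱ[ℝ] E d).toAffineEquiv (F p.2)) ∘
      fun q => (Γ.aff (q.2, q.1.2), q.1.1)
  have hinj : Function.Injective fun q : (Fin m × Γ.pointGroup) × Γ.lattice =>
      ((Γ.aff (q.2, q.1.2), q.1.1) : Γ.grp × Fin m) := by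
    rintro ⟨⟨i, g⟩, v⟩ ⟨⟨j, h⟩, l⟩ hq
    have h0 : Γ.aff (v, g) = Γ.aff (l, h) := congrArg Prod.fst hq
    have h1 := Γ.aff_bijective.1 h0
    have h2 : i = j := congrArg Prod.snd hq
    have h3 : v = l := congrArg Prod.fst h1
    have h4 : g = h := congrArg Prod.snd h1
    rw [h2, h3, h4]
  have hw : Orthonormal ℂ w := hO.comp _ hinj
  have hwn : ∀ q v, ‖w (q, v)‖ = 1 := fun q v => hw.1 (q, v)
  have hwsub : Set.range w ⊆ Set.range fun p : Γ.grp × Fin m =>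
      D (p.1 : E d ≃ᵃⁱ[ℝ] E d).toAffineEquiv (F p.2) := by
    rintro _ ⟨q, rfl⟩
    exact ⟨(Γ.aff (q.2, q.1.2), q.1.1), rfl⟩
  have hB := hV.orthonormal_unitDilated
  have hexp : ∀ q v, HasSum (fun p : Γ.lattice × Γ.pointGroup =>
      (coeffMatrix a (cF q.1) (p.1 - a.onLattice v) q.2 p.2 / s) • unitDilated a φ p) (w (q, v)) :=
    fun q v => (hF q.1).hasSum_unitDilated v q.2
  have key := mem_closure_span_of_card_eq (R := Fin m × Γ.pointGroup) (S := Fin m × Γ.pointGroup)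
    (Λ := Γ.lattice) rfl
    (B := fun p => unitDilated a φ (cosetEquiv a ht (p.1.1, p.2), p.1.2)) (w := w)
    (fun p => hB.1 _) hw
    (fun r q l => conj (coeffMatrix a (cF q.1) (a.onLattice l + t r.1) q.2 r.2 / s))
    (fun r l q v => by
      rw [← inner_conj_symm, inner_eq_of_hasSum hB (hexp q v)]
      rw [cosetEquiv_apply, a.onLattice_sub, sub_add_eq_add_sub])
    (fun q => by
      have h1 := hasSum_norm_sq_of_hasSum hB (hexp q 0)
      rw [hwn, one_pow, a.onLattice_zero] at h1
      let e : (Fin m × Γ.pointGroup) × Γ.lattice ≃ Γ.lattice × Γ.pointGroup :=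
        { toFun := fun p => (cosetEquiv a ht (p.1.1, p.2), p.1.2)
          invFun := fun p => ((((cosetEquiv a ht).symm p.1).1, p.2), ((cosetEquiv a ht).symm p.1).2)
          left_inv := fun p => by simp
          right_inv := fun p => by simp }
      refine (e.hasSum_iff.2 h1).congr_fun fun p => ?_
      rw [RCLike.norm_conj]
      simp only [Function.comp, sub_zero]
      rfl)
  rw [← hV.V_one_eq]
  refine Submodule.topologicalClosure_minimal _ ?_ (Submodule.isClosed_topologicalClosure _)
  rw [Submodule.span_le]
  rintro _ ⟨⟨k, g⟩, rfl⟩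
  have h1 := key ((((cosetEquiv a ht).symm k).1, g), ((cosetEquiv a ht).symm k).2)
  simp only [Prod.mk.eta, Equiv.apply_symm_apply] at h1
  exact Submodule.topologicalClosure_mono (Submodule.span_mono hwsub) h1

end MRA

/-! ### Wavelet bases and symmetric coefficients -/

section Wavelet

open ComplexConjugate

variable {d n : ℕ} {Γ : SplittingCrystalGroup d} {a : AdmissibleMatrix Γ} {φ : L2 d}
  {V : ℤ → Submodule ℂ (L2 d)}

/-- The family `D_γ ψ^l` is an orthonormal basis of `W₀` as soon as it is orthonormal together with
the family `D_γ φ`. -/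
theorem translatesBasis_iff_orthonormal (hV : IsMRA a (fun _ : Fin 1 => φ) V)
    {t : Fin (n + 1) → Γ.lattice} (ht : IsCosetReps Γ.lattice (a.lin : E d →ₗ[ℝ] E d) t)
    {c₀ : Γ.grp → ℂ} (hc₀ : HasScalarExpansion a φ c₀ φ)
    {ψ : Fin n → L2 d} {c : Fin n → Γ.grp → ℂ} (hc : ∀ l, HasScalarExpansion a φ (c l) (ψ l)) :
    TranslatesBasis (Γ := Γ) V ψ ↔ Orthonormal ℂ (fun p : Γ.grp × Fin (n + 1) =>
      D (p.1 : E d ≃ᵃⁱ[ℝ] E d).toAffineEquiv ((Fin.cons φ ψ : Fin (n + 1) → L2 d) p.2)) := by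
  classical
  let S := Submodule.span ℂ (Set.range fun p : Γ.grp × Fin n =>
    D (p.1 : E d ≃ᵃⁱ[ℝ] E d).toAffineEquiv (ψ p.2))
  constructor
  · rintro ⟨hO, hW⟩
    have hmem : ∀ (γ : Γ.grp) l, D (γ : E d ≃ᵃⁱ[ℝ] E d).toAffineEquiv (ψ l) ∈ (V 0)ᗮ := by
      intro γ l
      have h1 : D (γ : E d ≃ᵃⁱ[ℝ] E d).toAffineEquiv (ψ l) ∈ W V 0 := by
        rw [← hW]
        exact Submodule.le_topologicalClosure _ (Submodule.subset_span ⟨(γ, l), rfl⟩)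
      exact h1.1
    have hz : ∀ (γ γ' : Γ.grp) l, inner ℂ (D (γ : E d ≃ᵃⁱ[ℝ] E d).toAffineEquiv φ)
        (D (γ' : E d ≃ᵃⁱ[ℝ] E d).toAffineEquiv (ψ l)) = 0 := fun γ γ' l =>
      hmem γ' l _ (hV.D_mem γ)
    rw [orthonormal_iff_ite] at hO ⊢
    rintro ⟨γ, i⟩ ⟨γ', j⟩
    refine Fin.cases ?_ (fun i => ?_) i <;> refine Fin.cases ?_ (fun j => ?_) j
    · simp only [Fin.cons_zero, hV.inner_D, Prod.mk.injEq, and_true]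
    · simp only [Fin.cons_zero, Fin.cons_succ, hz]
      rw [if_neg]
      exact fun h => Fin.succ_ne_zero j (congrArg Prod.snd h).symm
    · simp only [Fin.cons_zero, Fin.cons_succ]
      rw [← inner_conj_symm, hz, map_zero, if_neg]
      exact fun h => Fin.succ_ne_zero i (congrArg Prod.snd h)
    · simp only [Fin.cons_succ]
      refine (hO (γ, i) (γ', j)).trans ?_
      simp only [Prod.mk.injEq, Fin.succ_inj]
  · intro hO
    have hcons : ∀ i, HasScalarExpansion a φ
        ((Fin.cons c₀ c : Fin (n + 1) → Γ.grp → ℂ) i) ((Fin.cons φ ψ : Fin (n + 1) → L2 d) i) :=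
      Fin.cases hc₀ hc
    have hfull := V_one_le_of_orthonormal hV ht hcons hO
    have hinj : Function.Injective fun p : Γ.grp × Fin n => ((p.1, p.2.succ) :
        Γ.grp × Fin (n + 1)) := by
      rintro ⟨γ, i⟩ ⟨γ', j⟩ h
      rw [Prod.mk.injEq, Fin.succ_inj] at h
      exact Prod.ext h.1 h.2
    have hOψ : Orthonormal ℂ (fun p : Γ.grp × Fin n =>
      D (p.1 : E d ≃ᵃⁱ[ℝ] E d).toAffineEquiv (ψ p.2)) := by
      have h := hO.comp _ hinj
      simp only [Function.comp_def, Fin.cons_succ] at h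
      exact h
    have hz : ∀ (γ γ' : Γ.grp) l, inner ℂ (D (γ : E d ≃ᵃⁱ[ℝ] E d).toAffineEquiv φ)
        (D (γ' : E d ≃ᵃⁱ[ℝ] E d).toAffineEquiv (ψ l)) = 0 := fun γ γ' l => by
      have h := hO.2 (i := (γ, 0)) (j := (γ', l.succ))
        fun h => Fin.succ_ne_zero l (congrArg Prod.snd h).symm
      simp only [Fin.cons_zero, Fin.cons_succ] at h
      exact h
    have hV0 : ∀ y, (∀ γ : Γ.grp, inner ℂ (D (γ : E d ≃ᵃⁱ[ℝ] E d).toAffineEquiv φ) y = 0) →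
        y ∈ (V 0)ᗮ := by
      intro y hy
      rw [← hV.basis.2, Submodule.orthogonal_closure, Submodule.mem_orthogonal]
      intro u hu
      induction hu using Submodule.span_induction with
      | mem u hu =>
        obtain ⟨p, rfl⟩ := hu
        exact hy p.1
      | zero => exact inner_zero_left _
      | add u v _ _ hu hv => rw [inner_add_left, hu, hv, add_zero]
      | smul z u _ hu => rw [inner_smul_left, hu, mul_zero]
    have hWcl : IsClosed (W V 0 : Set (L2 d)) :=
      (Submodule.isClosed_orthogonal (V 0)).inter (hV.closed 1)
    have hle : S.topologicalClosure ≤ W V 0 := by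
      refine Submodule.topologicalClosure_minimal _ ?_ hWcl
      rw [Submodule.span_le]
      rintro _ ⟨⟨γ, l⟩, rfl⟩
      exact ⟨hV0 _ fun γ' => hz γ' γ l, (hc l).D_mem hV γ⟩
    refine ⟨hOψ, le_antisymm hle fun x hx => ?_⟩
    change x ∈ S.topologicalClosure
    have : CompleteSpace S.topologicalClosure :=
      (Submodule.isClosed_topologicalClosure S).completeSpace_coe
    -- The component `z` of `x` orthogonal to all `D_γ ψ^l` lies in `W₀`, so it is orthogonal to the
    -- whole family, which is complete in `V₁`.
    obtain ⟨y, hy, z, hzo, rfl⟩ := S.topologicalClosure.exists_add_mem_mem_orthogonal x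
    have hzW : z ∈ W V 0 := by
      have h := (W V 0).sub_mem hx (hle hy)
      rwa [add_sub_cancel_left] at h
    have hz1 : z ∈ (Submodule.span ℂ (Set.range fun p : Γ.grp × Fin (n + 1) =>
        D (p.1 : E d ≃ᵃⁱ[ℝ] E d).toAffineEquiv
          ((Fin.cons φ ψ : Fin (n + 1) → L2 d) p.2))).topologicalClosureᗮ := by
      rw [Submodule.orthogonal_closure, Submodule.mem_orthogonal]
      intro u hu
      induction hu using Submodule.span_induction with
      | mem u hu =>
        obtain ⟨⟨γ, i⟩, rfl⟩ := hu
        refine Fin.cases ?_ (fun i => ?_) i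
        · exact hzW.1 _ (hV.D_mem γ)
        · exact hzo _ (Submodule.le_topologicalClosure _ (Submodule.subset_span ⟨(γ, i), rfl⟩))
      | zero => exact inner_zero_left _
      | add u v _ _ hu hv => rw [inner_add_left, hu, hv, add_zero]
      | smul z u _ hu => rw [inner_smul_left, hu, mul_zero]
    have h0 : z = 0 := inner_self_eq_zero.1 (hz1 z (hfull hzW.2))
    rw [h0, add_zero]
    exact hy

theorem AdmissibleMatrix.conj_one : a.conj 1 = 1 := by
  ext1
  refine LinearIsometryEquiv.ext fun x => ?_
  rw [a.conj_apply]
  simp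

theorem SplittingCrystalGroup.act_act (g h : Γ.pointGroup) (k : Γ.lattice) :
    Γ.act g (Γ.act h k) = Γ.act (g * h) k := rfl

/-- Coefficient matrices of a single function are always symmetric. -/
theorem hasSymmetry_coeffMatrix (c : Γ.grp → ℂ) : HasSymmetry a (coeffMatrix a c) := by
  intro g g' k
  simp only [coeffMatrix, Matrix.of_apply, AdmissibleMatrix.conj_one, inv_one, one_mul,
    SplittingCrystalGroup.act_act, mul_inv_rev, inv_inv]
  rw [mul_assoc, mul_inv_cancel, mul_one]

/-- A symmetric family consists of the coefficient matrices of some scalar coefficients. -/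
theorem HasSymmetry.exists_coeffMatrix {C : Γ.lattice → Matrix Γ.pointGroup Γ.pointGroup ℂ}
    (hC : HasSymmetry a C) : ∃ c : Γ.grp → ℂ, C = coeffMatrix a c := by
  refine ⟨fun γ => C (Γ.affEquiv.symm γ).1 1 (Γ.affEquiv.symm γ).2, ?_⟩
  funext k
  ext g g'
  have h : Γ.elt ((a.conj g)⁻¹ * g') (Γ.act g'⁻¹ k)
      = Γ.affEquiv (Γ.act (a.conj g)⁻¹ k, (a.conj g)⁻¹ * g') := by
    change _ = Γ.elt ((a.conj g)⁻¹ * g') (Γ.act ((a.conj g)⁻¹ * g')⁻¹ (Γ.act (a.conj g)⁻¹ k))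
    rw [SplittingCrystalGroup.act_act, mul_inv_rev, inv_inv, mul_assoc, mul_inv_cancel, mul_one]
  simp only [coeffMatrix, Matrix.of_apply]
  rw [h, Equiv.symm_apply_apply]
  exact hC g g' k

/-- Scalar coefficients whose coefficient matrices are square-summable define a function. -/
theorem exists_hasScalarExpansion (hV : IsMRA a (fun _ : Fin 1 => φ) V) {c : Γ.grp → ℂ}
    (hc : SquareSummable (coeffMatrix a c)) : ∃ f, HasScalarExpansion a φ c f := by
  have h1 : Summable fun p : Γ.lattice × Γ.pointGroup => ‖c (Γ.aff p)‖ ^ 2 := by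
    have h2 : ∀ g' : Γ.pointGroup, Summable fun k : Γ.lattice => ‖c (Γ.aff (k, g'))‖ ^ 2 := by
      intro g'
      refine (hc 1 g').congr fun k => ?_
      simp only [coeffMatrix, Matrix.of_apply, AdmissibleMatrix.conj_one, inv_one, one_mul]
      rfl
    have h3 := hasSum_prod_of_fintype (f := fun p : Γ.pointGroup × Γ.lattice =>
      ‖c (Γ.aff (p.2, p.1))‖ ^ 2) fun g' => (h2 g').hasSum
    exact ((Equiv.prodComm Γ.lattice Γ.pointGroup).summable_iff).2 h3.summable
  have h4 := (hV.orthonormal_unitDilated.summable_smul (summable_const_mul_sq h1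
    ((Real.sqrt |LinearMap.det (a.lin : E d →ₗ[ℝ] E d)| : ℝ) : ℂ)⁻¹)).hasSum
  refine ⟨_, Γ.affEquiv.hasSum_iff.1 (h4.congr_fun fun p => ?_)⟩
  rw [inv_mul_eq_div, ← smul_dilated, dilated_eq]
  rfl

/-- The vector function built from the coefficient matrices of `f` is the orbit of `f`. -/
theorem HasScalarExpansion.hasSum_vecTerm {f : L2 d} {c : Γ.grp → ℂ}
    (hc : HasScalarExpansion a φ c f) (g : Γ.pointGroup) :
    HasSum (fun k => vecTerm a φ (coeffMatrix a c) k g) (orbitVec f g) :=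
  (hc.hasSum_orbitVec g).prod_fiberwise fun _ => hasSum_fintype _

end Wavelet

/-! ### Uniqueness of coefficients and the equivalences -/

section Coefficients

variable {d n : ℕ} {Γ : SplittingCrystalGroup d} {a : AdmissibleMatrix Γ} {φ : L2 d}
  {V : ℤ → Submodule ℂ (L2 d)}

theorem vecTerm_eq (C : Γ.lattice → Matrix Γ.pointGroup Γ.pointGroup ℂ) (k : Γ.lattice)
    (g : Γ.pointGroup) : vecTerm a φ C k g = ∑ g', C k g g' • dilated a φ (k, g') := rfl

theorem hasSum_assocVec (hV : IsMRA a (fun _ : Fin 1 => φ) V)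
    {C : Γ.lattice → Matrix Γ.pointGroup Γ.pointGroup ℂ} (hC : SquareSummable C)
    (g : Γ.pointGroup) : HasSum (fun k => vecTerm a φ C k g) (assocVec a φ C g) := by
  have h1 := hasSum_prod_of_fintype (f := fun p : Γ.pointGroup × Γ.lattice => ‖C p.2 g p.1‖ ^ 2)
    fun g' => (hC g g').hasSum
  have h2 : Summable fun p : Γ.lattice × Γ.pointGroup => ‖C p.1 g p.2‖ ^ 2 :=
    ((Equiv.prodComm Γ.lattice Γ.pointGroup).summable_iff).2 h1.summable
  have h3 := (hV.orthonormal_unitDilated.summable_smul (summable_const_mul_sq h2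
    ((Real.sqrt |LinearMap.det (a.lin : E d →ₗ[ℝ] E d)| : ℝ) : ℂ)⁻¹)).hasSum
  have h4 := h3.prod_fiberwise fun k => hasSum_fintype _
  refine Summable.hasSum ⟨_, h4.congr_fun fun k => ?_⟩
  rw [vecTerm_eq]
  refine Finset.sum_congr rfl fun g' _ => ?_
  rw [smul_dilated, inv_mul_eq_div]

/-- The coefficient matrices of a vector function are unique. -/
theorem coeff_unique (hV : IsMRA a (fun _ : Fin 1 => φ) V)
    {C C' : Γ.lattice → Matrix Γ.pointGroup Γ.pointGroup ℂ} {F : Γ.pointGroup → L2 d}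
    (hC : ∀ g, HasSum (fun k => vecTerm a φ C k g) (F g))
    (hC' : ∀ g, HasSum (fun k => vecTerm a φ C' k g) (F g)) : C = C' := by
  classical
  have key : ∀ (C : Γ.lattice → Matrix Γ.pointGroup Γ.pointGroup ℂ),
      (∀ g, HasSum (fun k => vecTerm a φ C k g) (F g)) → ∀ k g g',
      inner ℂ (unitDilated a φ (k, g')) (F g)
        = C k g g' / ((Real.sqrt |LinearMap.det (a.lin : E d →ₗ[ℝ] E d)| : ℝ) : ℂ) := by
    intro C hC k g g'
    have h := (innerSL ℂ (unitDilated a φ (k, g'))).hasSum (hC g)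
    refine HasSum.unique h ((hasSum_ite_eq k _).congr_fun fun l => ?_)
    change inner ℂ (unitDilated a φ (k, g')) (vecTerm a φ C l g) = _
    rw [vecTerm_eq, inner_sum]
    simp only [smul_dilated, inner_smul_right,
      orthonormal_iff_ite.1 hV.orthonormal_unitDilated, Prod.mk.injEq]
    by_cases hl : l = k
    · subst hl
      simp
    · simp [hl, Ne.symm hl]
  funext k
  ext g g'
  have h := (key C hC k g g').symm.trans (key C' hC' k g g')
  exact (div_left_inj' (sqrt_det_ne_zero a)).1 h

/-- The functions of `V₁` are those with a scalar expansion. -/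
theorem IsMRA.exists_expansion (hV : IsMRA a (fun _ : Fin 1 => φ) V) {f : L2 d} (hf : f ∈ V 1) :
    ∃ c, HasScalarExpansion a φ c f := by
  have hB := hV.orthonormal_unitDilated
  have hs := hB.summable_smul (hB.inner_products_summable (x := f))
  have h1 := hs.hasSum
  set y := ∑' p, inner ℂ (unitDilated a φ p) f • unitDilated a φ p with hy
  have hyV : y ∈ (Submodule.span ℂ (Set.range (unitDilated a φ))).topologicalClosure :=
    mem_closure_of_tendsto h1 (Eventually.of_forall fun s =>
      Submodule.sum_mem _ fun i _ => Submodule.smul_mem _ _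
        (Submodule.subset_span (Set.mem_range_self i)))
  have hsub : f - y ∈ (Submodule.span ℂ (Set.range (unitDilated a φ))).topologicalClosure := by
    refine Submodule.sub_mem _ ?_ hyV
    rw [hV.V_one_eq]
    exact hf
  have horth : f - y ∈ (Submodule.span ℂ (Set.range (unitDilated a φ))).topologicalClosureᗮ := by
    rw [Submodule.orthogonal_closure, Submodule.mem_orthogonal]
    intro u hu
    induction hu using Submodule.span_induction with
    | mem u hu =>
      obtain ⟨p, rfl⟩ := hu
      rw [inner_sub_right, inner_eq_of_hasSum hB h1, sub_self]
    | zero => exact inner_zero_left _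
    | add u v _ _ hu hv => rw [inner_add_left, hu, hv, add_zero]
    | smul z u _ hu => rw [inner_smul_left, hu, mul_zero]
  have h0 : f = y := sub_eq_zero.1 (inner_self_eq_zero.1 (horth _ hsub))
  rw [← h0] at h1
  refine ⟨fun γ => ((Real.sqrt |LinearMap.det (a.lin : E d →ₗ[ℝ] E d)| : ℝ) : ℂ) *
    inner ℂ (unitDilated a φ (Γ.affEquiv.symm γ)) f,
    Γ.affEquiv.hasSum_iff.1 (h1.congr_fun fun p => ?_)⟩
  simp only [Function.comp, Equiv.symm_apply_apply]
  have h2 : dilated a φ p = comp φ (a.lin.toAffineEquiv.trans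
      (Γ.affEquiv p : E d ≃ᵃⁱ[ℝ] E d).symm.toAffineEquiv) := dilated_eq a φ p
  rw [← h2, smul_dilated, mul_div_cancel_left₀ _ (sqrt_det_ne_zero a)]

theorem orbitVec_mem_symV1 (hV : IsMRA a (fun _ : Fin 1 => φ) V) {f : L2 d} {c : Γ.grp → ℂ}
    (hc : HasScalarExpansion a φ c f) : orbitVec f ∈ symV1 a φ V := by
  refine ⟨fun g => ?_, coeffMatrix a c, hc.hasSum_vecTerm, hasSymmetry_coeffMatrix c⟩
  rw [orbitVec_eq]
  exact hc.D_mem hV _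

theorem allCoeff_eq {c₀ : Γ.grp → ℂ} {c : Fin n → Γ.grp → ℂ}
    {C : Fin n → Γ.lattice → Matrix Γ.pointGroup Γ.pointGroup ℂ}
    (hC : ∀ l, C l = coeffMatrix a (c l)) (i : Fin (n + 1)) :
    allCoeff a c₀ C i = coeffMatrix a ((Fin.cons c₀ c : Fin (n + 1) → Γ.grp → ℂ) i) := by
  refine Fin.cases rfl (fun l => ?_) i
  simp only [allCoeff, Fin.cons_succ, hC]

/-- The equivalences for functions `ψ^l` with given scalar coefficients. The symmetry conditions and
the membership in `𝕍₁` hold automatically here. -/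
theorem tfae_of_expansion
    (hm : ((n + 1 : ℕ) : ℝ) = |LinearMap.det (a.lin : E d →ₗ[ℝ] E d)|)
    {t : Fin (n + 1) → Γ.lattice} (ht : IsCosetReps Γ.lattice (a.lin : E d →ₗ[ℝ] E d) t)
    {ϱ : Fin (n + 1) → Γ.dualLattice}
    (hϱ : IsCosetReps Γ.dualLattice (LinearMap.adjoint (a.lin : E d →ₗ[ℝ] E d)) ϱ)
    (hV : IsMRA a (fun _ : Fin 1 => φ) V)
    {c₀ : Γ.grp → ℂ} (hc₀ : HasScalarExpansion a φ c₀ φ)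
    {ψ : Fin n → L2 d} {c : Fin n → Γ.grp → ℂ} (hc : ∀ l, HasScalarExpansion a φ (c l) (ψ l))
    {C : Fin n → Γ.lattice → Matrix Γ.pointGroup Γ.pointGroup ℂ}
    (hC : ∀ l, C l = coeffMatrix a (c l)) :
    List.TFAE [
      TranslatesBasis (Γ := Γ) V ψ,
      UnitaryAE (matU a t (allCoeff a c₀ C)) ∧ ∀ l, orbitVec (ψ l) ∈ symV1 a φ V,
      UnitaryAE (matM a ϱ (allCoeff a c₀ C)) ∧ ∀ l, orbitVec (ψ l) ∈ symV1 a φ V,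
      DiscreteOrthogonality a (allCoeff a c₀ C) ∧ ∀ i, HasSymmetry a (allCoeff a c₀ C i)] := by
  have hcons : ∀ i, HasScalarExpansion a φ
      ((Fin.cons c₀ c : Fin (n + 1) → Γ.grp → ℂ) i) ((Fin.cons φ ψ : Fin (n + 1) → L2 d) i) :=
    Fin.cases hc₀ hc
  have hall : allCoeff a c₀ C
      = fun i => coeffMatrix a ((Fin.cons c₀ c : Fin (n + 1) → Γ.grp → ℂ) i) :=
    funext (allCoeff_eq hC)
  have hsym : ∀ i, HasSymmetry a (allCoeff a c₀ C i) := fun i => by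
    rw [allCoeff_eq hC]
    exact hasSymmetry_coeffMatrix _
  have hsq : ∀ i, SquareSummable (allCoeff a c₀ C i) := fun i => by
    rw [allCoeff_eq hC]
    exact (hcons i).squareSummable hV
  have hmem : ∀ l, orbitVec (ψ l) ∈ symV1 a φ V := fun l => orbitVec_mem_symV1 hV (hc l)
  tfae_have 1 ↔ 4 := by
    rw [translatesBasis_iff_orthonormal hV ht hc₀ hc, orthonormal_D_iff hV hm hcons, ← hall]
    exact ⟨fun h => ⟨h, hsym⟩, And.left⟩
  tfae_have 2 ↔ 4 := by
    rw [unitaryAE_matU_iff a ht hsq]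
    exact ⟨fun h => ⟨h.1, hsym⟩, fun h => ⟨h.1, hmem⟩⟩
  tfae_have 3 ↔ 2 := by
    rw [unitaryAE_matM_iff a ht hϱ hsq]
  tfae_finish

end Coefficients

end CrystalWavelet

end

open CrystalWavelet in
theorem theorem4p4 {d n : ℕ} (Γ : SplittingCrystalGroup d) (a : AdmissibleMatrix Γ)
    -- `m = n + 1`
    (hm : ((n + 1 : ℕ) : ℝ) = |LinearMap.det (a.lin : E d →ₗ[ℝ] E d)|)
    (t : Fin (n + 1) → Γ.lattice) (ht : IsCosetReps Γ.lattice (a.lin : E d →ₗ[ℝ] E d) t)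
    (ϱ : Fin (n + 1) → Γ.dualLattice)
    (hϱ : IsCosetReps Γ.dualLattice (LinearMap.adjoint (a.lin : E d →ₗ[ℝ] E d)) ϱ)
    (V : ℤ → Submodule ℂ (L2 d)) (φ : L2 d) (hV : IsMRA a (fun _ : Fin 1 => φ) V)
    (c₀ : Γ.grp → ℂ) (hc₀ : HasScalarExpansion a φ c₀ φ) :
    -- starting from functions `ψ^l` in `V₁`
    (∀ (ψ : Fin n → L2 d) (c : Fin n → Γ.grp → ℂ), (∀ l, ψ l ∈ V 1) →
      (∀ l, HasScalarExpansion a φ (c l) (ψ l)) →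
      ∀ C : Fin n → Γ.lattice → Matrix Γ.pointGroup Γ.pointGroup ℂ,
      (∀ l, C l = coeffMatrix a (c l)) →
      List.TFAE [
        TranslatesBasis (Γ := Γ) V ψ,
        UnitaryAE (matU a t (allCoeff a c₀ C)) ∧ ∀ l, orbitVec (ψ l) ∈ symV1 a φ V,
        UnitaryAE (matM a ϱ (allCoeff a c₀ C)) ∧ ∀ l, orbitVec (ψ l) ∈ symV1 a φ V,
        DiscreteOrthogonality a (allCoeff a c₀ C) ∧ ∀ i, HasSymmetry a (allCoeff a c₀ C i)]) ∧
    -- starting from arbitrary coefficient matrices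
    (∀ C : Fin n → Γ.lattice → Matrix Γ.pointGroup Γ.pointGroup ℂ,
      (∀ l, SquareSummable (C l)) →
      List.TFAE [
        ∃ ψ : Fin n → L2 d, (∀ l, assocVec a φ (C l) = orbitVec (ψ l)) ∧
          TranslatesBasis (Γ := Γ) V ψ,
        UnitaryAE (matU a t (allCoeff a c₀ C)) ∧ ∀ l, assocVec a φ (C l) ∈ symV1 a φ V,
        UnitaryAE (matM a ϱ (allCoeff a c₀ C)) ∧ ∀ l, assocVec a φ (C l) ∈ symV1 a φ V,
        DiscreteOrthogonality a (allCoeff a c₀ C) ∧ ∀ i, HasSymmetry a (allCoeff a c₀ C i)]) := by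
  refine ⟨fun ψ c _ hc C hC => tfae_of_expansion hm ht hϱ hV hc₀ hc hC, fun C hsq => ?_⟩
  have hassoc := fun l g => hasSum_assocVec hV (hsq l) g
  -- Symmetric families come from functions in `V₁`.
  have hmain : (∀ l, HasSymmetry a (C l)) → List.TFAE [
        ∃ ψ : Fin n → L2 d, (∀ l, assocVec a φ (C l) = orbitVec (ψ l)) ∧
          TranslatesBasis (Γ := Γ) V ψ,
        UnitaryAE (matU a t (allCoeff a c₀ C)) ∧ ∀ l, assocVec a φ (C l) ∈ symV1 a φ V,
        UnitaryAE (matM a ϱ (allCoeff a c₀ C)) ∧ ∀ l, assocVec a φ (C l) ∈ symV1 a φ V,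
        DiscreteOrthogonality a (allCoeff a c₀ C) ∧ ∀ i, HasSymmetry a (allCoeff a c₀ C i)] := by
    intro hsym
    choose c hC using fun l => (hsym l).exists_coeffMatrix
    choose ψ hc using fun l => exists_hasScalarExpansion hV (hC l ▸ hsq l)
    have heq : ∀ l, assocVec a φ (C l) = orbitVec (ψ l) := fun l => funext fun g =>
      (hassoc l g).unique (hC l ▸ (hc l).hasSum_vecTerm g)
    have h1 : (∃ ψ : Fin n → L2 d, (∀ l, assocVec a φ (C l) = orbitVec (ψ l)) ∧
        TranslatesBasis (Γ := Γ) V ψ) ↔ TranslatesBasis (Γ := Γ) V ψ := by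
      refine ⟨?_, fun h => ⟨ψ, heq, h⟩⟩
      rintro ⟨ψ', h', hT⟩
      have : ψ' = ψ := funext fun l => by
        rw [← orbitVec_one (Γ := Γ) (ψ' l), ← h', heq, orbitVec_one]
      rwa [← this]
    rw [h1]
    simp only [heq]
    exact tfae_of_expansion hm ht hϱ hV hc₀ hc hC
  -- Each of the four conditions makes all the families `C l` symmetric.
  have hsymV : (∀ l, assocVec a φ (C l) ∈ symV1 a φ V) → ∀ l, HasSymmetry a (C l) := by
    intro h l
    obtain ⟨-, C', hC', hs⟩ := h l
    rwa [coeff_unique hV (hassoc l) hC']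
  have hsymT : (∃ ψ : Fin n → L2 d, (∀ l, assocVec a φ (C l) = orbitVec (ψ l)) ∧
      TranslatesBasis (Γ := Γ) V ψ) → ∀ l, HasSymmetry a (C l) := by
    rintro ⟨ψ, hψ, -, hT⟩ l
    have h1 : ψ l ∈ V 1 := by
      have h2 : D ((1 : Γ.grp) : E d ≃ᵃⁱ[ℝ] E d).toAffineEquiv (ψ l) ∈ W V 0 := by
        rw [← hT]
        exact Submodule.le_topologicalClosure _ (Submodule.subset_span ⟨(1, l), rfl⟩)
      have h3 := h2.2
      rw [Subgroup.coe_one, D_one] at h3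
      simpa using h3
    obtain ⟨c, hc⟩ := hV.exists_expansion h1
    rw [coeff_unique hV (hassoc l) fun g => hψ l ▸ hc.hasSum_vecTerm g]
    exact hasSymmetry_coeffMatrix c
  have hsymC : (∀ i, HasSymmetry a (allCoeff a c₀ C i)) → ∀ l, HasSymmetry a (C l) :=
    fun h l => h l.succ
  tfae_have 1 → 2 := fun h => ((hmain (hsymT h)).out 0 1).1 h
  tfae_have 2 → 3 := fun h => ((hmain (hsymV h.2)).out 1 2).1 h
  tfae_have 3 → 4 := fun h => ((hmain (hsymV h.2)).out 2 3).1 h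
  tfae_have 4 → 1 := fun h => ((hmain (hsymC h.2)).out 3 0).1 h
  tfae_finish
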